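/- Let $\mathbb{T}=\mathbb{R}/2\pi\mathbb{Z}$, $\alpha\in(0,1)$, and let $F\in C^4(\mathbb{R};\mathbb{R})$ satisfy $F'>-\lambda_1$ on $\mathbb{R}$, where $\lambda_1$ is the first eigenvalue of the Dirichlet Laplacian on the channel $\mathbb{T}\times(-1,1)$. Let $c_G,c_H\in\mathbb{R}$ and let $\psi_0\in C^2(\mathbb{T}\times[-1,1])$ be a non-constant solution of $$\Delta\psi_0=F(\psi_0)\ \text{ in } \mathbb{T}\times(-1,1),\qquad \psi_0(x,1)=c_H,\quad \psi_0(x,-1)=c_G \quad (x\in\mathbb{T}),$$ which has a stagnation point (a point where $\nabla\psi_0=0$) at some height $y_0\in(-1,1)$. Then for every $(g,h)\in (C^{2,\alpha}(\mathbb{T}))^2$ the problem $$(\Delta-F'(\psi_0))\varphi=0\ \text{ in } \mathbb{T}\times(-1,1),\qquad \varphi(x,1)=-h(x)\,\partial_y\psi_0(x,1),\quad \varphi(x,-1)=-g(x)\,\partial_y\psi_0(x,-1)\quad (x\in\mathbb{T})$$ has a unique classical solution $\varphi=\varphi_{g,h}$ ($C^2$ in $\mathbb{T}\times(-1,1)$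 and continuous on $\mathbb{T}\times[-1,1]$), and the set $$\mathcal{B}_0=\Big\{(g,h)\in (C^{2,\alpha}(\mathbb{T}))^2:\ \max_{x\in\mathbb{T}}\varphi_{g,h}(x,y_0)\neq 0\ \text{ and }\ \partial_x^2\varphi_{g,h}(x_0,y_0)<0 \text{ for every global maximizer } x_0 \text{ of } \varphi_{g,h}(\cdot,y_0)\Big\}$$ is open and dense in $(C^{2,\alpha}(\mathbb{T}))^2$. -/

import Mathlib

open Set Topology

noncomputable section

namespace Channel

/-! ### The Hölder space of twice differentiable periodic functions

The torus is the real line modulo `2π`; a function on it is a `2π`-periodic function on the line. -/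

/-- The additive group underlying `C^{2,α}` of the torus. -/
def holderSubgroup (α : ℝ) : AddSubgroup (ℝ → ℝ) where
  carrier := {f | ContDiff ℝ 2 f ∧ Function.Periodic f (2 * Real.pi) ∧
    ∃ C : ℝ, ∀ x y : ℝ, |iteratedDeriv 2 f x - iteratedDeriv 2 f y| ≤ C * |x - y| ^ α}
  zero_mem' := by
    refine ⟨contDiff_const, fun x => rfl, 0, fun x y => ?_⟩
    simp
  add_mem' := by
    rintro f g ⟨hf, pf, C, hC⟩ ⟨hg, pg, D, hD⟩
    refine ⟨hf.add hg, pf.add pg, C + D, fun x y => ?_⟩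
    rw [iteratedDeriv_add hf.contDiffAt hg.contDiffAt,
      iteratedDeriv_add hf.contDiffAt hg.contDiffAt]
    calc _ = |(iteratedDeriv 2 f x - iteratedDeriv 2 f y)
          + (iteratedDeriv 2 g x - iteratedDeriv 2 g y)| := by congr 1; ring
      _ ≤ _ := abs_add_le _ _
      _ ≤ _ := by rw [add_mul]; exact add_le_add (hC x y) (hD x y)
  neg_mem' := by
    rintro f ⟨hf, pf, C, hC⟩
    refine ⟨hf.neg, fun x => congrArg Neg.neg (pf x), C, fun x y => ?_⟩
    rw [iteratedDeriv_neg, iteratedDeriv_neg]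
    calc _ = |iteratedDeriv 2 f x - iteratedDeriv 2 f y| := by
          rw [← abs_neg]; congr 1; ring
      _ ≤ _ := hC x y

/-- The space `C^{2,α}(𝕋)`. It is a type of its own, so that it carries the Hölder norm below
and not the topology of pointwise convergence. -/
def HolderC2 (α : ℝ) : Type := holderSubgroup α

namespace HolderC2

variable {α : ℝ}

instance : CoeFun (HolderC2 α) (fun _ => ℝ → ℝ) := ⟨fun f => f.1⟩

instance : AddCommGroup (HolderC2 α) := inferInstanceAs (AddCommGroup (holderSubgroup α))

/-- The supremum of the absolute value of the `k`-th derivative. -/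
def supDeriv (k : ℕ) (f : ℝ → ℝ) : ℝ := ⨆ x : ℝ, |iteratedDeriv k f x|

/-- The `α`-Hölder seminorm of the second derivative. The pairs `x = y` contribute `0`. By
periodicity, the distance on the line gives the same supremum as the one on the torus. -/
def holderSeminorm (α : ℝ) (f : ℝ → ℝ) : ℝ :=
  ⨆ p : ℝ × ℝ, |iteratedDeriv 2 f p.1 - iteratedDeriv 2 f p.2| / |p.1 - p.2| ^ α

/-- The `C^{2,α}` norm. -/
def holderNorm (α : ℝ) (f : ℝ → ℝ) : ℝ :=
  supDeriv 0 f + supDeriv 1 f + supDeriv 2 f + holderSeminorm α f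

lemma contDiff (f : HolderC2 α) : ContDiff ℝ 2 f := f.2.1

lemma periodic (f : HolderC2 α) : Function.Periodic f (2 * Real.pi) := f.2.2.1

lemma coe_add (f g : HolderC2 α) : ((f + g : HolderC2 α) : ℝ → ℝ) = f.1 + g.1 := rfl

lemma coe_neg (f : HolderC2 α) : ((-f : HolderC2 α) : ℝ → ℝ) = -f.1 := rfl

lemma coe_zero : ((0 : HolderC2 α) : ℝ → ℝ) = 0 := rfl

lemma periodic_iteratedDeriv (k : ℕ) (f : HolderC2 α) :
    Function.Periodic (iteratedDeriv k f) (2 * Real.pi) := by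
  intro x
  have h := congrFun (iteratedDeriv_comp_add_const k (f : ℝ → ℝ) (2 * Real.pi)) x
  rw [← h]
  congr 1
  funext z
  exact f.periodic z

lemma bddAbove_deriv (f : HolderC2 α) {k : ℕ} (hk : k ≤ 2) :
    BddAbove (range fun x => |iteratedDeriv k f x|) := by
  have hc : Continuous (fun x => |iteratedDeriv k (f : ℝ → ℝ) x|) :=
    (f.contDiff.continuous_iteratedDeriv k (by exact_mod_cast hk)).abs
  have hp : Function.Periodic (fun x => |iteratedDeriv k (f : ℝ → ℝ) x|) (2 * Real.pi) := by
    intro x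
    simp only [f.periodic_iteratedDeriv k x]
  exact (hp.compact_of_continuous (by positivity) hc).bddAbove

lemma bddAbove_quotient (f : HolderC2 α) :
    BddAbove (range fun p : ℝ × ℝ =>
      |iteratedDeriv 2 f p.1 - iteratedDeriv 2 f p.2| / |p.1 - p.2| ^ α) := by
  obtain ⟨C, hC⟩ := f.2.2.2
  refine ⟨max C 0, ?_⟩
  rintro _ ⟨⟨x, y⟩, rfl⟩
  dsimp only
  by_cases h : x = y
  · subst h; simp
  · have : 0 < |x - y| ^ α := Real.rpow_pos_of_pos (abs_pos.mpr (sub_ne_zero.mpr h)) _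
    exact le_max_of_le_left ((div_le_iff₀ this).mpr (hC x y))

lemma supDeriv_nonneg (k : ℕ) (f : ℝ → ℝ) : 0 ≤ supDeriv k f :=
  Real.iSup_nonneg fun _ => abs_nonneg _

lemma holderSeminorm_nonneg (f : ℝ → ℝ) : 0 ≤ holderSeminorm α f :=
  Real.iSup_nonneg fun _ => div_nonneg (abs_nonneg _) (Real.rpow_nonneg (abs_nonneg _) _)

lemma supDeriv_add_le (f g : HolderC2 α) {k : ℕ} (hk : k ≤ 2) :
    supDeriv k (f + g : HolderC2 α) ≤ supDeriv k f + supDeriv k g := by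
  refine ciSup_le fun x => ?_
  have hk' : (k : WithTop ℕ∞) ≤ 2 := by exact_mod_cast hk
  rw [coe_add, iteratedDeriv_add (f.contDiff.of_le hk').contDiffAt
    (g.contDiff.of_le hk').contDiffAt]
  exact (abs_add_le _ _).trans
    (add_le_add (le_ciSup (f.bddAbove_deriv hk) x) (le_ciSup (g.bddAbove_deriv hk) x))

lemma holderSeminorm_add_le (f g : HolderC2 α) :
    holderSeminorm α (f + g : HolderC2 α) ≤ holderSeminorm α f + holderSeminorm α g := by
  refine ciSup_le fun p => ?_
  refine le_trans ?_ (add_le_add (le_ciSup f.bddAbove_quotient p)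
    (le_ciSup g.bddAbove_quotient p))
  rw [← add_div]
  refine div_le_div_of_nonneg_right ?_ (Real.rpow_nonneg (abs_nonneg _) _)
  rw [coe_add, iteratedDeriv_add f.contDiff.contDiffAt g.contDiff.contDiffAt,
    iteratedDeriv_add f.contDiff.contDiffAt g.contDiff.contDiffAt]
  refine le_trans (le_of_eq ?_) (abs_add_le _ _)
  congr 1
  ring

instance : NormedAddCommGroup (HolderC2 α) :=
  AddGroupNorm.toNormedAddCommGroup
    { toFun := fun f => holderNorm α f
      map_zero' := by
        simp [holderNorm, supDeriv, holderSeminorm, coe_zero]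
      add_le' := by
        intro f g
        have h0 := supDeriv_add_le f g (k := 0) (by norm_num)
        have h1 := supDeriv_add_le f g (k := 1) (by norm_num)
        have h2 := supDeriv_add_le f g (k := 2) le_rfl
        have h3 := holderSeminorm_add_le f g
        simp only [holderNorm]
        linarith
      neg' := by
        intro f
        have h : ∀ k x, iteratedDeriv k ((-f : HolderC2 α) : ℝ → ℝ) x
            = - iteratedDeriv k (f : ℝ → ℝ) x := by
          intro k x
          rw [coe_neg, iteratedDeriv_neg]
        have h' : ∀ a b : ℝ, |-a - -b| = |a - b| := by
          intro a b
          rw [← abs_neg]; congr 1; ring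
        simp only [holderNorm, supDeriv, holderSeminorm, h, h', abs_neg]
      eq_zero_of_map_eq_zero' := by
        intro f hf
        have h0 := supDeriv_nonneg 0 (f : ℝ → ℝ)
        have h1 := supDeriv_nonneg 1 (f : ℝ → ℝ)
        have h2 := supDeriv_nonneg 2 (f : ℝ → ℝ)
        have h3 := holderSeminorm_nonneg (α := α) (f : ℝ → ℝ)
        have hs : supDeriv 0 (f : ℝ → ℝ) = 0 := by
          simp only [holderNorm] at hf
          linarith
        apply Subtype.ext
        funext x
        have hx := le_ciSup (f.bddAbove_deriv (k := 0) (by norm_num)) x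
        have hx' : |iteratedDeriv 0 (f : ℝ → ℝ) x| ≤ 0 := hx.trans hs.le
        have hx0 : (f : ℝ → ℝ) x = 0 := by simpa using hx'
        exact hx0 }

lemma norm_def (f : HolderC2 α) : ‖f‖ = holderNorm α f := rfl

end HolderC2

/-! ### The flat channel `𝕋 × [-1, 1]` -/

/-- The function `u` is `2π`-periodic in its first variable, over the closed channel. -/
def PeriodicInX (u : ℝ → ℝ → ℝ) : Prop :=
  ∀ x, ∀ y ∈ Icc (-1 : ℝ) 1, u (x + 2 * Real.pi) y = u x y

/-- The Laplacian `∂_x² u + ∂_y² u`; it is used at interior points for `C²` functions only. -/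
def lap (u : ℝ → ℝ → ℝ) (x y : ℝ) : ℝ :=
  iteratedDeriv 2 (fun s => u s y) x + iteratedDeriv 2 (fun t => u x t) y

/-- Functions on the channel that are `C²` inside and continuous up to the boundary: the class
of classical solutions of Dirichlet problems. -/
def IsClassical (u : ℝ → ℝ → ℝ) : Prop :=
  PeriodicInX u ∧
  ContDiffOn ℝ 2 (fun p : ℝ × ℝ => u p.1 p.2) (univ ×ˢ Ioo (-1 : ℝ) 1) ∧
  ContinuousOn (fun p : ℝ × ℝ => u p.1 p.2) (univ ×ˢ Icc (-1 : ℝ) 1)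

/-- The number `μ` is an eigenvalue of the Dirichlet Laplacian `-Δ` on the channel. -/
def IsDirichletEigenvalue (μ : ℝ) : Prop :=
  ∃ u : ℝ → ℝ → ℝ, IsClassical u ∧
    (∃ x, ∃ y ∈ Icc (-1 : ℝ) 1, u x y ≠ 0) ∧
    (∀ x, ∀ y ∈ Ioo (-1 : ℝ) 1, -lap u x y = μ * u x y) ∧
    (∀ x, u x 1 = 0) ∧ (∀ x, u x (-1) = 0)

/-- The first eigenvalue of the Dirichlet Laplacian on the channel. -/
def firstDirichletEigenvalue : ℝ := sInf {μ | IsDirichletEigenvalue μ}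

/-- The stream function `ψ` is a steady state of the channel, `C²` up to the boundary: it solves
`Δψ = F(ψ)` with the constant values `cG` on `y = -1` and `cH` on `y = 1`. -/
def IsSteadyState (F : ℝ → ℝ) (cG cH : ℝ) (ψ : ℝ → ℝ → ℝ) : Prop :=
  PeriodicInX ψ ∧
  ContDiffOn ℝ 2 (fun p : ℝ × ℝ => ψ p.1 p.2) (univ ×ˢ Icc (-1 : ℝ) 1) ∧
  (∀ x, ∀ y ∈ Ioo (-1 : ℝ) 1, lap ψ x y = F (ψ x y)) ∧
  (∀ x, ψ x 1 = cH) ∧ (∀ x, ψ x (-1) = cG)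

/-- The function `ψ` is not constant on the closed channel. -/
def IsNonconstant (ψ : ℝ → ℝ → ℝ) : Prop :=
  ∃ x, ∃ y ∈ Icc (-1 : ℝ) 1, ∃ x', ∃ y' ∈ Icc (-1 : ℝ) 1, ψ x y ≠ ψ x' y'

/-- The function `ψ` has a stagnation point (`∇ψ = 0`) at height `y₀`. -/
def StagnatesAt (ψ : ℝ → ℝ → ℝ) (y₀ : ℝ) : Prop :=
  ∃ x, deriv (fun s => ψ s y₀) x = 0 ∧ deriv (fun t => ψ x t) y₀ = 0

/-- The derivative `∂_y ψ` at a point of the closed channel; one-sided on the boundary. -/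
def dy (ψ : ℝ → ℝ → ℝ) (x y : ℝ) : ℝ := derivWithin (fun t => ψ x t) (Icc (-1 : ℝ) 1) y

/-- The function `φ` is a first order correction for the boundary perturbation `(g, h)`:
`(Δ - F'(ψ)) φ = 0`, with `φ = -h ∂_y ψ` on `y = 1` and `φ = -g ∂_y ψ` on `y = -1`. -/
def IsFirstCorrection (F : ℝ → ℝ) (ψ : ℝ → ℝ → ℝ) (g h : ℝ → ℝ) (φ : ℝ → ℝ → ℝ) : Prop :=
  IsClassical φ ∧
  (∀ x, ∀ y ∈ Ioo (-1 : ℝ) 1, lap φ x y - deriv F (ψ x y) * φ x y = 0) ∧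
  (∀ x, φ x 1 = -h x * dy ψ x 1) ∧ (∀ x, φ x (-1) = -g x * dy ψ x (-1))

/-- The set `𝓑₀` of the perturbations `(g, h)` whose first order correction `φ` satisfies
`max φ(·, y₀) ≠ 0` and `∂_x² φ(x₀, y₀) < 0` at every global maximizer `x₀` of `φ(·, y₀)`. -/
def B0 (α : ℝ) (F : ℝ → ℝ) (ψ : ℝ → ℝ → ℝ) (y₀ : ℝ) : Set (HolderC2 α × HolderC2 α) :=
  {p | ∃ φ : ℝ → ℝ → ℝ, IsFirstCorrection F ψ p.1 p.2 φ ∧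
    (⨆ x, φ x y₀) ≠ 0 ∧
    ∀ x₀, (∀ x, φ x y₀ ≤ φ x₀ y₀) → iteratedDeriv 2 (fun s => φ s y₀) x₀ < 0}

end Channel

end

namespace Channel

/-! ### The maximum principle -/

/-! The first eigenvalue is at most `(π/2)²` and `ψ₀` is bounded, so on the range of `ψ₀` one has
`F' > -a²` for some `a < π/2`. The function `cos (a y)` is then positive on the closed channel and a
strict supersolution of `Δ - q` for every `q > -a²`. Comparison with it gives a maximum principle
(`nonpos_of_subsolution`) and uniqueness for the Dirichlet problem (`eq_zero_of_dirichlet`), with no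
regularity asked of `q`.

Uniqueness makes `ψ₀` a shear flow. The difference of `ψ₀` and a horizontal translate vanishes on
both walls and solves a linear equation whose potential is a difference quotient of `F`, hence a
value of `F'`. The potential `F'(ψ₀) = c(y)` of the linearized problem therefore depends on the
height only, and Fourier series in `x` separate the variables. Mode `k` has a profile with `B'' =
(k² + c) B`, `B(-1) = 0`, `B(1) = 1`. The maximum principle gives its existence by shooting, its
positivity, and a decay away from the upper wall that is exponential in `k`. The series of modes
thus solves the problem (`exists_dirichlet_top`), and at height `y₀` both the solution and its
second `x`-derivative are controlled by the sup norm of the data alone. Data on the lower wall are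
treated by reflection.

Openness: having a nonzero maximum with only nondegenerate maximizers is stable under `C²`-small
perturbations of a periodic function, and the correction depends linearly and boundedly on `(g, h)`.

Density: `∂_y ψ₀` solves the homogeneous linear equation, so if it vanished on both walls it would
vanish identically and `ψ₀` would be constant. Some wall thus transmits data. A cosine put there
produces `r cos (x - z)` at height `y₀`, with any phase `z` and any amplitude `r`. With `z` a
maximizer of the given trace and `r > 0` small, every maximizer of the sum is nondegenerate, and the
maximum is nonzero except for at most one `r`. -/

lemma iteratedDeriv_two_nonpos_of_isLocalMax {f : ℝ → ℝ} {x : ℝ} (h : IsLocalMax f x)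
    (hc : ContinuousAt f x) : iteratedDeriv 2 f x ≤ 0 := by
  rw [iteratedDeriv_succ, iteratedDeriv_one]
  by_contra! hpos
  -- A positive second derivative would make `x` a local minimum as well, so `f` would be locally
  -- constant with zero second derivative.
  have hmin := isLocalMin_of_deriv_deriv_pos hpos h.deriv_eq_zero hc
  have hconst : f =ᶠ[𝓝 x] fun _ => f x := by
    filter_upwards [h, hmin] with y h1 h2 using le_antisymm h1 h2
  have h1 : deriv f =ᶠ[𝓝 x] fun _ => 0 := by
    refine hconst.deriv.trans ?_
    filter_upwards with y
    simp
  rw [h1.deriv_eq] at hpos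
  simp at hpos

/-! ### Algebra and symmetries of classical functions and of the Laplacian. -/

lemma isOpen_strip : IsOpen (univ ×ˢ Ioo (-1 : ℝ) 1 : Set (ℝ × ℝ)) := isOpen_univ.prod isOpen_Ioo

lemma strip_mem_nhds {x y : ℝ} (hy : y ∈ Ioo (-1 : ℝ) 1) :
    (univ ×ˢ Ioo (-1 : ℝ) 1 : Set (ℝ × ℝ)) ∈ 𝓝 (x, y) := isOpen_strip.mem_nhds ⟨mem_univ _, hy⟩

lemma lap_const_mul (u : ℝ → ℝ → ℝ) (r x y : ℝ) :
    lap (fun x y => r * u x y) x y = r * lap u x y := by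
  simp only [lap, iteratedDeriv_const_mul_field]
  ring

namespace IsClassical

variable {u v : ℝ → ℝ → ℝ}

lemma contDiffAt_fst (hu : IsClassical u) (x : ℝ) {y : ℝ} (hy : y ∈ Ioo (-1 : ℝ) 1) :
    ContDiffAt ℝ 2 (fun s => u s y) x :=
  (hu.2.1.contDiffAt (strip_mem_nhds (x := x) hy)).comp x
    (f := fun s : ℝ => (s, y)) (contDiffAt_id.prodMk contDiffAt_const)

lemma contDiffAt_snd (hu : IsClassical u) (x : ℝ) {y : ℝ} (hy : y ∈ Ioo (-1 : ℝ) 1) :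
    ContDiffAt ℝ 2 (fun t => u x t) y :=
  (hu.2.1.contDiffAt (strip_mem_nhds (x := x) hy)).comp y
    (f := fun t : ℝ => (x, t)) (contDiffAt_const.prodMk contDiffAt_id)

lemma add (hu : IsClassical u) (hv : IsClassical v) :
    IsClassical (fun x y => u x y + v x y) :=
  ⟨fun x y hy => by simp only [hu.1 x y hy, hv.1 x y hy], hu.2.1.add hv.2.1, hu.2.2.add hv.2.2⟩

lemma const_mul (hu : IsClassical u) (r : ℝ) : IsClassical (fun x y => r * u x y) :=
  ⟨fun x y hy => by simp only [hu.1 x y hy], contDiffOn_const.mul hu.2.1, continuousOn_const.mul hu.2.2⟩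

lemma lap_add (hu : IsClassical u) (hv : IsClassical v) (x : ℝ) {y : ℝ}
    (hy : y ∈ Ioo (-1 : ℝ) 1) :
    lap (fun x y => u x y + v x y) x y = lap u x y + lap v x y := by
  unfold lap
  rw [iteratedDeriv_fun_add (hu.contDiffAt_fst x hy) (hv.contDiffAt_fst x hy),
    iteratedDeriv_fun_add (hu.contDiffAt_snd x hy) (hv.contDiffAt_snd x hy)]
  ring

lemma sub (hu : IsClassical u) (hv : IsClassical v) :
    IsClassical (fun x y => u x y - v x y) := by
  simpa [sub_eq_add_neg] using hu.add (hv.const_mul (-1))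

lemma lap_sub (hu : IsClassical u) (hv : IsClassical v) (x : ℝ) {y : ℝ}
    (hy : y ∈ Ioo (-1 : ℝ) 1) :
    lap (fun x y => u x y - v x y) x y = lap u x y - lap v x y := by
  have := hu.lap_add (hv.const_mul (-1)) x hy
  rw [lap_const_mul] at this
  simpa [sub_eq_add_neg] using this

/-- A function of the second variable only, `C²` inside and continuous up to the boundary. -/
lemma of_snd {f : ℝ → ℝ} (h1 : ContDiffOn ℝ 2 f (Ioo (-1) 1)) (h2 : ContinuousOn f (Icc (-1) 1)) :
    IsClassical (fun _ y => f y) :=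
  ⟨fun _ _ _ => rfl, h1.comp contDiffOn_snd fun _ hp => hp.2,
    h2.comp continuousOn_snd fun _ hp => hp.2⟩

lemma translate (hu : IsClassical u) (s : ℝ) : IsClassical (fun x y => u (x + s) y) := by
  have hcd : ContDiff ℝ 2 (fun p : ℝ × ℝ => (p.1 + s, p.2)) :=
    (contDiff_fst.add contDiff_const).prodMk contDiff_snd
  refine ⟨fun x y hy => ?_, ?_, ?_⟩
  · simp only [show x + 2 * Real.pi + s = x + s + 2 * Real.pi by ring, hu.1 _ y hy]
  · exact hu.2.1.comp hcd.contDiffOn fun p hp => ⟨mem_univ _, hp.2⟩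
  · exact hu.2.2.comp hcd.continuous.continuousOn fun p hp => ⟨mem_univ _, hp.2⟩

lemma reflect (hu : IsClassical u) : IsClassical (fun x y => u x (-y)) := by
  have hcd : ContDiff ℝ 2 (fun p : ℝ × ℝ => (p.1, -p.2)) := contDiff_fst.prodMk contDiff_snd.neg
  refine ⟨fun x y hy => hu.1 x (-y) ?_, ?_, ?_⟩
  · exact ⟨by linarith [hy.2], by linarith [hy.1]⟩
  · exact hu.2.1.comp hcd.contDiffOn
      fun p hp => ⟨mem_univ _, ⟨by linarith [hp.2.2], by linarith [hp.2.1]⟩⟩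
  · exact hu.2.2.comp hcd.continuous.continuousOn
      fun p hp => ⟨mem_univ _, ⟨by linarith [hp.2.2], by linarith [hp.2.1]⟩⟩

/-- The trace on an inner horizontal line is of class `C²`. -/
lemma contDiff_fst (hu : IsClassical u) {y : ℝ} (hy : y ∈ Ioo (-1 : ℝ) 1) :
    ContDiff ℝ 2 (fun s => u s y) :=
  contDiff_iff_contDiffAt.2 fun x => hu.contDiffAt_fst x hy

end IsClassical

lemma lap_translate (u : ℝ → ℝ → ℝ) (s x y : ℝ) :
    lap (fun x y => u (x + s) y) x y = lap u (x + s) y := by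
  unfold lap
  congr 1
  exact congrFun (iteratedDeriv_comp_add_const 2 (fun r => u r y) s) x

lemma lap_reflect (u : ℝ → ℝ → ℝ) (x y : ℝ) :
    lap (fun x y => u x (-y)) x y = lap u x (-y) := by
  unfold lap
  congr 1
  have := iteratedDeriv_comp_neg 2 (fun r => u x r) y
  simpa using this

lemma lap_snd (f : ℝ → ℝ) (x y : ℝ) : lap (fun _ y => f y) x y = iteratedDeriv 2 f y := by
  simp [lap, iteratedDeriv_const]

lemma cos_mul_pos {a y : ℝ} (ha : 0 < a) (ha' : a < Real.pi / 2) (hy : y ∈ Icc (-1 : ℝ) 1) :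
    0 < Real.cos (a * y) := by
  apply Real.cos_pos_of_mem_Ioo
  constructor <;> nlinarith [hy.1, hy.2]

lemma iteratedDeriv_two_cos_mul (a y : ℝ) :
    iteratedDeriv 2 (fun t => Real.cos (a * t)) y = -a ^ 2 * Real.cos (a * y) := by
  have h1 : ∀ t, HasDerivAt (fun t => Real.cos (a * t)) (-Real.sin (a * t) * a) t := fun t => by
    have := ((hasDerivAt_id t).const_mul a).cos
    simpa using this
  have h2 : HasDerivAt (fun t => -Real.sin (a * t) * a) (-(Real.cos (a * y) * a) * a) y := by
    have := ((((hasDerivAt_id y).const_mul a).sin).neg).mul_const a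
    simpa using this
  rw [iteratedDeriv_succ, iteratedDeriv_one, show deriv (fun t => Real.cos (a * t)) = _ from
    funext fun t => (h1 t).deriv, h2.deriv]
  ring

/-- **Maximum principle** for `Δ - q` on the channel, with `q` above minus the first eigenvalue. -/
theorem nonpos_of_subsolution {a : ℝ} (ha : 0 < a) (ha' : a < Real.pi / 2) {v q : ℝ → ℝ → ℝ}
    (hv : IsClassical v) (hq : ∀ x, ∀ y ∈ Ioo (-1 : ℝ) 1, -a ^ 2 < q x y)
    (hsub : ∀ x, ∀ y ∈ Ioo (-1 : ℝ) 1, q x y * v x y ≤ lap v x y)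
    (htop : ∀ x, v x 1 ≤ 0) (hbot : ∀ x, v x (-1) ≤ 0) :
    ∀ x, ∀ y ∈ Icc (-1 : ℝ) 1, v x y ≤ 0 := by
  -- The weight satisfies `w'' = -a² w` and is positive up to the walls because `a < π/2`. The
  -- quotient `v / w` is maximized in place of `v`, since `q` may be negative.
  set w : ℝ → ℝ := fun y => Real.cos (a * y) with hw
  have hwpos : ∀ y ∈ Icc (-1 : ℝ) 1, 0 < w y := fun y hy => cos_mul_pos ha ha' hy
  have hwc : ContDiff ℝ 2 w := by fun_prop
  by_contra! hcon
  obtain ⟨x₁, y₁, hy₁, hpos⟩ := hcon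
  have hcont : ContinuousOn (fun p : ℝ × ℝ => v p.1 p.2 / w p.2)
      (Icc 0 (2 * Real.pi) ×ˢ Icc (-1 : ℝ) 1) := by
    refine ContinuousOn.div (hv.2.2.mono (prod_mono_left (subset_univ _))) ?_ ?_
    · exact (hwc.continuous.comp continuous_snd).continuousOn
    · exact fun p hp => (hwpos _ hp.2).ne'
  obtain ⟨⟨x, y⟩, ⟨hx, hy⟩, hmax⟩ := (isCompact_Icc.prod isCompact_Icc).exists_isMaxOn
    ⟨((0 : ℝ), (0 : ℝ)), ⟨by simp; positivity, by norm_num⟩⟩ hcont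
  have hglobal : ∀ s, ∀ t ∈ Icc (-1 : ℝ) 1, v s t / w t ≤ v x y / w y := by
    intro s t ht
    have hper : Function.Periodic (fun s => v s t) (2 * Real.pi) := fun s => hv.1 s t ht
    obtain ⟨s', hs', he⟩ := hper.exists_mem_Ico₀ (by positivity) s
    have h1 : v s t = v s' t := he
    rw [h1]
    exact hmax (a := (s', t)) ⟨⟨hs'.1, hs'.2.le⟩, ht⟩
  set M := v x y / w y with hM
  have hMpos : 0 < M := (div_pos hpos (hwpos _ hy₁)).trans_le (hglobal x₁ y₁ hy₁)
  have hle : ∀ s, ∀ t ∈ Icc (-1 : ℝ) 1, v s t - M * w t ≤ 0 := fun s t ht => by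
    have := (div_le_iff₀ (hwpos t ht)).1 (hglobal s t ht)
    linarith
  have heq : v x y = M * w y := by rw [hM, div_mul_cancel₀ _ (hwpos y hy).ne']
  have hvpos : 0 < v x y := heq ▸ mul_pos hMpos (hwpos y hy)
  have hy' : y ∈ Ioo (-1 : ℝ) 1 := by
    refine ⟨lt_of_le_of_ne hy.1 ?_, lt_of_le_of_ne hy.2 ?_⟩
    · rintro rfl; exact absurd (hbot x) hvpos.not_ge
    · rintro rfl; exact absurd (htop x) hvpos.not_ge
  -- Since `v - M w ≤ 0` with equality at `(x, y)`, both pure second derivatives of `v - M w` are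
  -- nonpositive there. Hence `Δv ≤ -a² M w = -a² v < q v`, against `hsub`.
  have hxx : iteratedDeriv 2 (fun s => v s y) x ≤ 0 := by
    refine iteratedDeriv_two_nonpos_of_isLocalMax ?_ (hv.contDiffAt_fst x hy').continuousAt
    filter_upwards with s
    linarith [hle s y hy]
  have hyy : iteratedDeriv 2 (fun t => v x t - M * w t) y ≤ 0 := by
    refine iteratedDeriv_two_nonpos_of_isLocalMax ?_ ?_
    · filter_upwards [isOpen_Ioo.mem_nhds hy'] with t ht
      linarith [hle x t (Ioo_subset_Icc_self ht)]
    · exact (hv.contDiffAt_snd x hy').continuousAt.sub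
        (continuous_const.mul hwc.continuous).continuousAt
  rw [iteratedDeriv_fun_sub (hv.contDiffAt_snd x hy') (contDiff_const.mul hwc).contDiffAt,
    iteratedDeriv_const_mul_field, hw, iteratedDeriv_two_cos_mul] at hyy
  have h1 := hsub x y hy'
  have h2 := mul_lt_mul_of_pos_right (hq x y hy') hvpos
  unfold lap at h1
  have h3 : M * (-a ^ 2 * Real.cos (a * y)) = -a ^ 2 * v x y := by rw [heq, hw]; ring
  linarith

/-- The Dirichlet problem for `Δ - q` has at most one solution. -/
theorem eq_zero_of_dirichlet {a : ℝ} (ha : 0 < a) (ha' : a < Real.pi / 2) {v q : ℝ → ℝ → ℝ}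
    (hv : IsClassical v) (hq : ∀ x, ∀ y ∈ Ioo (-1 : ℝ) 1, -a ^ 2 < q x y)
    (heq : ∀ x, ∀ y ∈ Ioo (-1 : ℝ) 1, lap v x y = q x y * v x y)
    (htop : ∀ x, v x 1 = 0) (hbot : ∀ x, v x (-1) = 0) :
    ∀ x, ∀ y ∈ Icc (-1 : ℝ) 1, v x y = 0 := by
  intro x y hy
  have h1 := nonpos_of_subsolution ha ha' hv hq (fun x y hy => (heq x y hy).ge)
    (fun x => (htop x).le) (fun x => (hbot x).le) x y hy
  have h2 := nonpos_of_subsolution ha ha' (hv.const_mul (-1)) hq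
    (fun x y hy => by rw [lap_const_mul, heq x y hy]; exact le_of_eq (by ring))
    (fun x => by rw [htop]; simp) (fun x => by rw [hbot]; simp) x y hy
  linarith

/-- The one-dimensional maximum principle. -/
theorem le_of_subsolution_supersolution {a : ℝ} (ha : 0 < a) (ha' : a < Real.pi / 2)
    {u w q : ℝ → ℝ}
    (hu : ContDiffOn ℝ 2 u (Ioo (-1) 1)) (hu' : ContinuousOn u (Icc (-1) 1))
    (hw : ContDiffOn ℝ 2 w (Ioo (-1) 1)) (hw' : ContinuousOn w (Icc (-1) 1))
    (hq : ∀ y ∈ Ioo (-1 : ℝ) 1, -a ^ 2 < q y)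
    (hsub : ∀ y ∈ Ioo (-1 : ℝ) 1, q y * u y ≤ iteratedDeriv 2 u y)
    (hsup : ∀ y ∈ Ioo (-1 : ℝ) 1, iteratedDeriv 2 w y ≤ q y * w y)
    (htop : u 1 ≤ w 1) (hbot : u (-1) ≤ w (-1)) :
    ∀ y ∈ Icc (-1 : ℝ) 1, u y ≤ w y := by
  intro y hy
  have hcu := IsClassical.of_snd hu hu'
  have hcw := IsClassical.of_snd hw hw'
  have := nonpos_of_subsolution ha ha' (hcu.sub hcw) (q := fun _ y => q y) (fun _ => hq)
    (fun x y hy => by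
      rw [hcu.lap_sub hcw x hy, lap_snd, lap_snd]
      linarith [hsub y hy, hsup y hy])
    (fun _ => by linarith) (fun _ => by linarith) 0 y hy
  linarith

/-! ### The ordinary differential equation of a single Fourier mode -/

/-- The initial value problem `s'' = q s`, `s(-1) = 0`, `s'(-1) = 1` is solvable on `[-1, 1]`. -/
theorem exists_linear_ivp {q : ℝ → ℝ} (hq : Continuous q) :
    ∃ s p : ℝ → ℝ, s (-1) = 0 ∧ p (-1) = 1 ∧ ∀ t ∈ Icc (-1 : ℝ) 1,
      HasDerivWithinAt s (p t) (Icc (-1) 1) t ∧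
      HasDerivWithinAt p (q t * s t) (Icc (-1) 1) t := by
  obtain ⟨Q₀, hQ₀⟩ := (isCompact_Icc (a := (-1 : ℝ)) (b := 1)).exists_bound_of_continuousOn
    hq.continuousOn
  obtain ⟨Q, hQ1, hQ⟩ : ∃ Q : NNReal, 1 ≤ Q ∧ ∀ t ∈ Icc (-1 : ℝ) 1, |q t| ≤ Q := by
    refine ⟨(max 1 Q₀).toNNReal, ?_, fun t ht => ?_⟩
    · rw [Real.one_le_toNNReal]; exact le_max_left _ _
    · rw [Real.coe_toNNReal _ (zero_le_one.trans (le_max_left _ _))]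
      exact (hQ₀ t ht).trans (le_max_right _ _)
  have hQ1' : (1 : ℝ) ≤ Q := by exact_mod_cast hQ1
  -- The vector field is truncated at level `R`, so that one Picard–Lindelöf step covers the whole
  -- interval. By Grönwall, data of norm 1 grow at most to `exp (2 Q)` over the length 2, so the
  -- truncation is never active along the solution.
  set R : NNReal := ⟨Real.exp (2 * Q), (Real.exp_pos _).le⟩ with hR
  set cl : ℝ → ℝ := fun x => max (-R) (min R x) with hcl
  have hcllip : ∀ x y, |cl x - cl y| ≤ |x - y| := by
    have : LipschitzWith 1 cl := (LipschitzWith.id.const_min (R : ℝ)).const_max (-R : ℝ)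
    intro x y
    simpa [Real.dist_eq] using this.dist_le_mul x y
  have hR0 : (0 : ℝ) ≤ R := R.2
  have hclR : ∀ x, |cl x| ≤ R := fun x =>
    abs_le.2 ⟨le_max_left _ _, max_le (by linarith) (min_le_left _ _)⟩
  have hclself : ∀ x, |cl x| ≤ |x| := fun x => by
    have := hcllip x 0
    have h0 : cl 0 = 0 := by simp [hcl]
    simpa [h0] using this
  have hclid : ∀ x : ℝ, |x| ≤ R → cl x = x := fun x hx => by
    rw [hcl]
    simp only
    rw [min_eq_right (abs_le.1 hx).2, max_eq_right (abs_le.1 hx).1]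
  set f : ℝ → ℝ × ℝ → ℝ × ℝ := fun t z => (cl z.2, q t * cl z.1) with hf
  have hfle : ∀ t ∈ Icc (-1 : ℝ) 1, ∀ z, ∀ A : ℝ, |cl z.1| ≤ A → |cl z.2| ≤ A →
      ‖f t z‖ ≤ Q * A := by
    intro t ht z A h1 h2
    have hA : 0 ≤ A := (abs_nonneg _).trans h1
    rw [Prod.norm_def, Real.norm_eq_abs, Real.norm_eq_abs, abs_mul]
    refine max_le ?_ (mul_le_mul (hQ t ht) h1 (abs_nonneg _) Q.2)
    nlinarith
  have hpl : IsPicardLindelof f (tmin := -1) (tmax := 1) ⟨-1, by norm_num⟩ ((0 : ℝ), (1 : ℝ))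
      (2 * (Q * R)) 0 (Q * R) Q := by
    constructor
    · intro t ht
      refine LipschitzWith.lipschitzOnWith (LipschitzWith.of_dist_le_mul fun z z' => ?_)
      have h1 : |z.1 - z'.1| ≤ dist z z' := by rw [Prod.dist_eq]; exact le_max_left _ _
      have h2 : |z.2 - z'.2| ≤ dist z z' := by rw [Prod.dist_eq]; exact le_max_right _ _
      rw [@Prod.dist_eq _ _ _ _ (f t z), Real.dist_eq, Real.dist_eq]
      simp only [hf]
      rw [← mul_sub, abs_mul]
      refine max_le ?_ (mul_le_mul (hQ t ht) ((hcllip _ _).trans h1) (abs_nonneg _) Q.2)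
      have := (hcllip z.2 z'.2).trans h2
      nlinarith [dist_nonneg (x := z) (y := z')]
    · intro z _
      exact (continuous_const.prodMk (hq.mul continuous_const)).continuousOn
    · intro t ht z _
      push_cast
      exact hfle t ht z R (hclR _) (hclR _)
    · simp only [NNReal.coe_mul, NNReal.coe_ofNat, NNReal.coe_zero, sub_neg_eq_add]
      norm_num
      linarith
  obtain ⟨z, hz0, hz⟩ := hpl.exists_eq_forall_mem_Icc_hasDerivWithinAt₀
  have hzc : ContinuousOn z (Icc (-1) 1) := fun t ht => (hz t ht).continuousWithinAt
  have hbound : ∀ t ∈ Icc (-1 : ℝ) 1, ‖z t‖ ≤ R := by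
    intro t ht
    have h := norm_le_gronwallBound_of_norm_deriv_right_le (δ := 1) (K := Q) (ε := 0) hzc
      (fun x hx => (hz x ⟨hx.1, hx.2.le⟩).mono_of_mem_nhdsWithin
        (Icc_mem_nhdsGE_of_mem hx)) (by rw [hz0]; simp [Prod.norm_def])
      (fun x hx => by
        rw [add_zero]
        exact hfle x ⟨hx.1, hx.2.le⟩ _ _ ((hclself _).trans (norm_fst_le (z x)))
          ((hclself _).trans (norm_snd_le (z x)))) t ht
    rw [gronwallBound_ε0, one_mul] at h
    refine h.trans (Real.exp_le_exp.2 ?_)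
    nlinarith [ht.2]
  refine ⟨fun t => (z t).1, fun t => (z t).2, congrArg Prod.fst hz0, congrArg Prod.snd hz0, fun t ht => ?_⟩
  have h := hz t ht
  have h1 : (f t (z t)).1 = (z t).2 := hclid _ ((norm_snd_le (z t)).trans (hbound t ht))
  have h2 : (f t (z t)).2 = q t * (z t).1 := by
    simp only [hf]
    rw [hclid _ ((norm_fst_le (z t)).trans (hbound t ht))]
  have hfst : HasDerivWithinAt (fun t => (z t).1) (f t (z t)).1 (Icc (-1) 1) t := by
    simpa using (HasFDerivWithinAt.fst h).hasDerivWithinAt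
  have hsnd : HasDerivWithinAt (fun t => (z t).2) (f t (z t)).2 (Icc (-1) 1) t := by
    simpa using (HasFDerivWithinAt.snd h).hasDerivWithinAt
  exact ⟨hfst.congr_deriv h1, hsnd.congr_deriv h2⟩

/-- A solution of `s'' = r` with continuous `r` is of class `C²`. -/
lemma contDiffOn_two_of_hasDerivAt {s p r : ℝ → ℝ} {U : Set ℝ} (hU : IsOpen U)
    (hs : ∀ t ∈ U, HasDerivAt s (p t) t) (hp : ∀ t ∈ U, HasDerivAt p (r t) t)
    (hr : ContinuousOn r U) : ContDiffOn ℝ 2 s U := by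
  rw [show (2 : WithTop ℕ∞) = 1 + 1 by norm_num, contDiffOn_succ_iff_deriv_of_isOpen hU]
  refine ⟨fun t ht => (hs t ht).differentiableAt.differentiableWithinAt, by simp, ?_⟩
  refine ContDiffOn.congr (f := p) ?_ fun t ht => (hs t ht).deriv
  rw [show (1 : WithTop ℕ∞) = 0 + 1 by norm_num, contDiffOn_succ_iff_deriv_of_isOpen hU]
  refine ⟨fun t ht => (hp t ht).differentiableAt.differentiableWithinAt, by simp, ?_⟩
  rw [contDiffOn_zero]
  exact hr.congr fun t ht => (hp t ht).deriv

lemma iteratedDeriv_two_of_hasDerivAt {s p : ℝ → ℝ} {r t : ℝ} {U : Set ℝ} (hU : U ∈ 𝓝 t)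
    (hs : ∀ t ∈ U, HasDerivAt s (p t) t) (hp : HasDerivAt p r t) : iteratedDeriv 2 s t = r := by
  rw [iteratedDeriv_succ, iteratedDeriv_one]
  have : deriv s =ᶠ[𝓝 t] p := by
    filter_upwards [hU] with u hu using (hs u hu).deriv
  rw [this.deriv_eq, hp.deriv]

/-- The solution `B` of `B'' = q B` on `[-1, 1]` with `B(-1) = 0` and `B(1) = 1`, and its
derivative `B'`. -/
structure IsProfile (q B B' : ℝ → ℝ) : Prop where
  bot : B (-1) = 0
  top : B 1 = 1
  cont : ContinuousOn B (Icc (-1) 1)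
  deriv_fst : ∀ y ∈ Ioo (-1 : ℝ) 1, HasDerivAt B (B' y) y
  deriv_snd : ∀ y ∈ Ioo (-1 : ℝ) 1, HasDerivAt B' (q y * B y) y

lemma IsProfile.contDiffOn {q B B' : ℝ → ℝ} (h : IsProfile q B B') (hq : Continuous q) :
    ContDiffOn ℝ 2 B (Ioo (-1) 1) :=
  contDiffOn_two_of_hasDerivAt isOpen_Ioo h.deriv_fst h.deriv_snd
    (hq.continuousOn.mul (h.cont.mono Ioo_subset_Icc_self))

lemma IsProfile.iteratedDeriv_two {q B B' : ℝ → ℝ} (h : IsProfile q B B') {y : ℝ}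
    (hy : y ∈ Ioo (-1 : ℝ) 1) : iteratedDeriv 2 B y = q y * B y :=
  iteratedDeriv_two_of_hasDerivAt (isOpen_Ioo.mem_nhds hy) h.deriv_fst (h.deriv_snd y hy)

/-- Shooting from `-1` with slope 1 gives a solution `s`. If `s 1 = 0`, uniqueness for the Dirichlet
problem would force `s = 0`, contradicting the slope; so `s / s 1` is the profile. -/
theorem exists_isProfile {a : ℝ} (ha : 0 < a) (ha' : a < Real.pi / 2) {q : ℝ → ℝ}
    (hq : Continuous q) (hqa : ∀ y ∈ Icc (-1 : ℝ) 1, -a ^ 2 < q y) :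
    ∃ B B' : ℝ → ℝ, IsProfile q B B' := by
  obtain ⟨s, p, hs0, hp0, h⟩ := exists_linear_ivp hq
  have hsc : ContinuousOn s (Icc (-1) 1) := fun t ht => (h t ht).1.continuousWithinAt
  have hs : ∀ t ∈ Ioo (-1 : ℝ) 1, HasDerivAt s (p t) t := fun t ht =>
    (h t (Ioo_subset_Icc_self ht)).1.hasDerivAt (Icc_mem_nhds ht.1 ht.2)
  have hp : ∀ t ∈ Ioo (-1 : ℝ) 1, HasDerivAt p (q t * s t) t := fun t ht =>
    (h t (Ioo_subset_Icc_self ht)).2.hasDerivAt (Icc_mem_nhds ht.1 ht.2)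
  have hs1 : s 1 ≠ 0 := by
    intro hs1
    have hcd := contDiffOn_two_of_hasDerivAt isOpen_Ioo hs hp
      (hq.continuousOn.mul (hsc.mono Ioo_subset_Icc_self))
    have hzero := eq_zero_of_dirichlet ha ha' (IsClassical.of_snd hcd hsc)
      (q := fun _ y => q y) (fun _ y hy => hqa y (Ioo_subset_Icc_self hy))
      (fun x y hy => by
        rw [lap_snd, iteratedDeriv_two_of_hasDerivAt (isOpen_Ioo.mem_nhds hy) hs (hp y hy)])
      (fun _ => hs1) (fun _ => hs0) 0
    have h0 : HasDerivWithinAt s 0 (Icc (-1) 1) (-1) :=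
      (hasDerivWithinAt_const (-1 : ℝ) _ (0 : ℝ)).congr (fun t ht => hzero t ht) hs0
    have := (uniqueDiffOn_Icc (by norm_num : (-1 : ℝ) < 1) (-1) (by norm_num)).eq_deriv _
      h0 (h (-1) (by norm_num)).1
    rw [hp0] at this
    exact zero_ne_one this
  refine ⟨fun y => s y / s 1, fun y => p y / s 1, by simp [hs0], by simp [hs1],
    hsc.div_const _, fun y hy => (hs y hy).div_const _, fun y hy => ?_⟩
  have := (hp y hy).div_const (s 1)
  rwa [mul_div_assoc] at this

/-- A profile is positive. -/
theorem IsProfile.pos {a : ℝ} (ha : 0 < a) (ha' : a < Real.pi / 2) {q B B' : ℝ → ℝ}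
    (h : IsProfile q B B') (hq : Continuous q) (hqa : ∀ y ∈ Icc (-1 : ℝ) 1, -a ^ 2 < q y) :
    ∀ y ∈ Ioc (-1 : ℝ) 1, 0 < B y := by
  obtain ⟨Q, hQ⟩ := (isCompact_Icc (a := (-1 : ℝ)) (b := 1)).exists_bound_of_continuousOn
    hq.continuousOn
  -- `K ≥ 1` gives `q ≤ K ≤ K²`, so `sinh (K (y + 1)) / sinh (2 K)` is a subsolution with the
  -- boundary values of `B`, positive above `-1`.
  set K := max 1 Q
  have hK : 1 ≤ K := le_max_left _ _
  have hK' : ∀ y ∈ Icc (-1 : ℝ) 1, q y ≤ K ^ 2 := fun y hy => by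
    have := (le_abs_self _).trans ((hQ y hy).trans (le_max_right 1 Q))
    change q y ≤ K at this
    nlinarith
  have hs2 : 0 < Real.sinh (K * 2) := Real.sinh_pos_iff.2 (by linarith)
  have h1 : ∀ t, HasDerivAt (fun y => Real.sinh (K * (y + 1)) / Real.sinh (K * 2))
      (Real.cosh (K * (t + 1)) * K / Real.sinh (K * 2)) t := fun t => by
    have := ((((hasDerivAt_id t).add_const 1).const_mul K).sinh).div_const (Real.sinh (K * 2))
    simpa using this
  have h2 : ∀ t, HasDerivAt (fun t => Real.cosh (K * (t + 1)) * K / Real.sinh (K * 2))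
      (Real.sinh (K * (t + 1)) * K * K / Real.sinh (K * 2)) t := fun t => by
    have := (((((hasDerivAt_id t).add_const 1).const_mul K).cosh).mul_const K).div_const
      (Real.sinh (K * 2))
    simpa using this
  have hle := le_of_subsolution_supersolution ha ha'
    (u := fun y => Real.sinh (K * (y + 1)) / Real.sinh (K * 2)) (w := B) (q := q)
    (by fun_prop) (by fun_prop) (h.contDiffOn hq) h.cont
    (fun y hy => hqa y (Ioo_subset_Icc_self hy))
    (fun y hy => by
      rw [iteratedDeriv_two_of_hasDerivAt Filter.univ_mem (fun t _ => h1 t) (h2 y)]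
      have h3 : 0 ≤ Real.sinh (K * (y + 1)) / Real.sinh (K * 2) :=
        div_nonneg (Real.sinh_nonneg_iff.2 (by nlinarith [hy.1])) hs2.le
      have := mul_le_mul_of_nonneg_right (hK' y (Ioo_subset_Icc_self hy)) h3
      refine this.trans (le_of_eq ?_)
      ring)
    (fun y hy => (h.iteratedDeriv_two hy).le)
    (by rw [h.top]; norm_num [hs2.ne'])
    (by rw [h.bot]; norm_num)
  intro y hy
  refine lt_of_lt_of_le ?_ (hle y (Ioc_subset_Icc_self hy))
  exact div_pos (Real.sinh_pos_iff.2 (by nlinarith [hy.1])) hs2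

/-- The profiles of the Fourier modes decay exponentially away from the upper boundary, uniformly
in the frequency. -/
theorem exists_profile_decay {a : ℝ} (ha : 0 < a) (ha' : a < Real.pi / 2) {c : ℝ → ℝ}
    (hc : Continuous c) (hca : ∀ y ∈ Icc (-1 : ℝ) 1, -a ^ 2 < c y) :
    ∃ θ > 0, ∃ C > 0, ∀ (k : ℕ) (B B' : ℝ → ℝ), IsProfile (fun y => k ^ 2 + c y) B B' →
      ∀ y ∈ Icc (-1 : ℝ) 1, B y ≤ C * Real.exp (-(θ * k * (1 - y))) := by
  have hcosa : 0 < Real.cos a := by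
    simpa using cos_mul_pos ha ha' (y := 1) (by norm_num)
  have hsina : 0 < Real.sin a := Real.sin_pos_of_pos_of_lt_pi ha (by linarith [Real.pi_pos])
  -- The barrier is `cos (a y) exp (κ (y - 1)) / cos a` with `κ = θ k`. It is a supersolution once
  -- `κ² + 2 a κ τ ≤ k²`, where `τ = tan a` bounds the cross term. The choice of `θ` achieves this
  -- for all `k` at once, using `k ≤ k²` for natural numbers.
  set τ := Real.sin a / Real.cos a with hτ
  have hτ0 : 0 < τ := div_pos hsina hcosa
  have hden : 0 < 1 + 2 * a * τ := by positivity
  set θ := 1 / (1 + 2 * a * τ) with hθ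
  have hθ0 : 0 < θ := by positivity
  have hθ' : θ * (1 + 2 * a * τ) = 1 := by rw [hθ]; field_simp
  have hθ1 : θ ≤ 1 := by nlinarith [mul_pos hθ0 (mul_pos ha hτ0)]
  refine ⟨θ, hθ0, 1 / Real.cos a, by positivity, fun k B B' h y hy => ?_⟩
  set κ := θ * k with hκ
  have hk0 : (0 : ℝ) ≤ k := k.cast_nonneg
  have hκ0 : 0 ≤ κ := by positivity
  have hκk : κ ^ 2 + 2 * a * κ * τ ≤ (k : ℝ) ^ 2 := by
    have hkk : (k : ℝ) ≤ k ^ 2 := by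
      rcases Nat.eq_zero_or_pos k with rfl | hk
      · simp
      · have : (1 : ℝ) ≤ k := by exact_mod_cast hk
        nlinarith
    have h1 : κ ^ 2 ≤ θ * (k : ℝ) ^ 2 := by
      rw [hκ, mul_pow]
      exact mul_le_mul_of_nonneg_right (by nlinarith) (by positivity)
    have h2 : 2 * a * κ * τ ≤ θ * (2 * a * τ) * (k : ℝ) ^ 2 := by
      rw [hκ]
      have : 0 ≤ θ * (2 * a * τ) := by positivity
      nlinarith [mul_le_mul_of_nonneg_left hkk this]
    calc _ ≤ θ * (1 + 2 * a * τ) * (k : ℝ) ^ 2 := by linarith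
      _ = _ := by rw [hθ', one_mul]
  have hE : ∀ t, HasDerivAt (fun y => Real.exp (κ * (y - 1))) (Real.exp (κ * (t - 1)) * κ) t :=
    fun t => by simpa using (((hasDerivAt_id t).sub_const 1).const_mul κ).exp
  have hC : ∀ t, HasDerivAt (fun y => Real.cos (a * y)) (-Real.sin (a * t) * a) t := fun t => by
    simpa using ((hasDerivAt_id t).const_mul a).cos
  have hS : ∀ t, HasDerivAt (fun y => Real.sin (a * y)) (Real.cos (a * t) * a) t := fun t => by
    simpa using ((hasDerivAt_id t).const_mul a).sin
  have h1 : ∀ t, HasDerivAt (fun y => Real.cos (a * y) * Real.exp (κ * (y - 1)) / Real.cos a)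
      ((κ * Real.cos (a * t) - a * Real.sin (a * t)) * Real.exp (κ * (t - 1)) / Real.cos a) t :=
    fun t => by
      exact (((hC t).mul (hE t)).div_const (Real.cos a)).congr_deriv (by ring)
  have h2 : ∀ t, HasDerivAt (fun t => (κ * Real.cos (a * t) - a * Real.sin (a * t)) *
        Real.exp (κ * (t - 1)) / Real.cos a)
      (((κ ^ 2 - a ^ 2) * Real.cos (a * t) - 2 * a * κ * Real.sin (a * t)) *
        Real.exp (κ * (t - 1)) / Real.cos a) t := fun t => by
      exact (((((hC t).const_mul κ).sub ((hS t).const_mul a)).mul (hE t)).div_const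
        (Real.cos a)).congr_deriv (by simp only [Pi.sub_apply]; ring)
  have hqc : Continuous fun y => (k : ℝ) ^ 2 + c y := by fun_prop
  have hle := le_of_subsolution_supersolution ha ha' (u := B)
    (w := fun y => Real.cos (a * y) * Real.exp (κ * (y - 1)) / Real.cos a)
    (q := fun y => (k : ℝ) ^ 2 + c y)
    (h.contDiffOn hqc) h.cont (by fun_prop) (by fun_prop)
    (fun y hy => by nlinarith [hca y (Ioo_subset_Icc_self hy)])
    (fun y hy => (h.iteratedDeriv_two hy).ge)
    (fun y hy => by
      rw [iteratedDeriv_two_of_hasDerivAt Filter.univ_mem (fun t _ => h1 t) (h2 y),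
        ← mul_div_assoc, ← mul_assoc ((k : ℝ) ^ 2 + c y)]
      refine div_le_div_of_nonneg_right (mul_le_mul_of_nonneg_right ?_ (Real.exp_pos _).le)
        hcosa.le
      have hcy := cos_mul_pos ha ha' (Ioo_subset_Icc_self hy)
      -- This is `sin (a y + a) ≥ 0` divided by `cos a`; the angle lies in `[0, 2a]`, inside `[0,
      -- π]`.
      have hsy : -Real.sin (a * y) ≤ τ * Real.cos (a * y) := by
        have h0 : 0 ≤ Real.sin (a * y + a) :=
          Real.sin_nonneg_of_nonneg_of_le_pi (by nlinarith [hy.1]) (by nlinarith [hy.2])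
        rw [Real.sin_add] at h0
        rw [hτ, div_mul_eq_mul_div, le_div_iff₀ hcosa]
        linarith
      have h3 : 2 * a * κ * -Real.sin (a * y) ≤ 2 * a * κ * (τ * Real.cos (a * y)) :=
        mul_le_mul_of_nonneg_left hsy (by positivity)
      have h4 := mul_le_mul_of_nonneg_right hκk hcy.le
      have h5 := mul_le_mul_of_nonneg_right (hca y (Ioo_subset_Icc_self hy)).le hcy.le
      linarith)
    (by rw [h.top]; simp [hcosa.ne'])
    (by
      rw [h.bot]
      have : Real.cos (a * -1) = Real.cos a := by simp
      rw [this]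
      positivity) y hy
  refine hle.trans ?_
  have : Real.cos (a * y) * Real.exp (κ * (y - 1)) / Real.cos a
      = Real.cos (a * y) * (1 / Real.cos a * Real.exp (-(κ * (1 - y)))) := by
    rw [show κ * (y - 1) = -(κ * (1 - y)) by ring]; ring
  rw [this]
  exact mul_le_of_le_one_left (by positivity) (Real.cos_le_one _)

/-! ### Series of separated functions -/

section Series

variable {ι : Type*} {f f' f'' h h' h'' : ι → ℝ → ℝ} {A E : ι → ℝ} {I : Set ℝ}

lemma abs_mul_le_mul {s t a b : ℝ} (hs : |s| ≤ a) (ht : |t| ≤ b) : |s * t| ≤ a * b := by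
  rw [abs_mul]
  exact mul_le_mul hs ht (abs_nonneg _) ((abs_nonneg _).trans hs)

/-- Termwise differentiation of a series of separated functions. -/
lemma hasFDerivAt_tsum_mul (hI : IsOpen I) (hI' : IsPreconnected I)
    (hsum : Summable fun k => A k * E k)
    (hf : ∀ k x, HasDerivAt (f k) (f' k x) x) (hh : ∀ k, ∀ y ∈ I, HasDerivAt (h k) (h' k y) y)
    (bf : ∀ k x, |f k x| ≤ A k) (bf' : ∀ k x, |f' k x| ≤ A k)
    (bh : ∀ k, ∀ y ∈ I, |h k y| ≤ E k) (bh' : ∀ k, ∀ y ∈ I, |h' k y| ≤ E k)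
    (x : ℝ) {y : ℝ} (hy : y ∈ I) :
    HasFDerivAt (fun p : ℝ × ℝ => ∑' k, f k p.1 * h k p.2)
      ((∑' k, f' k x * h k y) • ContinuousLinearMap.fst ℝ ℝ ℝ +
        (∑' k, f k x * h' k y) • ContinuousLinearMap.snd ℝ ℝ ℝ) (x, y) := by
  have hs1 : Summable fun k => f' k x * h k y :=
    .of_norm_bounded hsum fun k => abs_mul_le_mul (bf' k x) (bh k y hy)
  have hs2 : Summable fun k => f k x * h' k y :=
    .of_norm_bounded hsum fun k => abs_mul_le_mul (bf k x) (bh' k y hy)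
  have hs0 : Summable fun k => f k x * h k y :=
    .of_norm_bounded hsum fun k => abs_mul_le_mul (bf k x) (bh k y hy)
  have key := hasFDerivAt_tsum_of_isPreconnected (𝕜 := ℝ) (s := (univ ×ˢ I : Set (ℝ × ℝ)))
    (f := fun k (p : ℝ × ℝ) => f k p.1 * h k p.2)
    (f' := fun k p => (f' k p.1 * h k p.2) • ContinuousLinearMap.fst ℝ ℝ ℝ +
        (f k p.1 * h' k p.2) • ContinuousLinearMap.snd ℝ ℝ ℝ)
    (u := fun k => A k * E k + A k * E k) (hsum.add hsum) (isOpen_univ.prod hI)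
    (isPreconnected_univ.prod hI')
    (fun k p hp => by
      have h1 := (hf k p.1).comp_hasFDerivAt p (hasFDerivAt_fst (𝕜 := ℝ))
      have h2 := (hh k p.2 hp.2).comp_hasFDerivAt p (hasFDerivAt_snd (𝕜 := ℝ))
      refine (h1.mul h2).congr_fderiv ?_
      ext <;> simp [mul_comm])
    (fun k p hp => by
      refine (norm_add_le _ _).trans (add_le_add ?_ ?_)
      · rw [norm_smul]
        refine (mul_le_of_le_one_right (norm_nonneg _)
          (ContinuousLinearMap.norm_fst_le ℝ ℝ ℝ)).trans ?_
        exact abs_mul_le_mul (bf' k _) (bh k _ hp.2)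
      · rw [norm_smul]
        refine (mul_le_of_le_one_right (norm_nonneg _)
          (ContinuousLinearMap.norm_snd_le ℝ ℝ ℝ)).trans ?_
        exact abs_mul_le_mul (bf k _) (bh' k _ hp.2))
    (x₀ := (x, y)) ⟨mem_univ _, hy⟩ hs0 (x := (x, y)) ⟨mem_univ _, hy⟩
  refine key.congr_fderiv ?_
  rw [Summable.tsum_add (hs1.smul_const _) (hs2.smul_const _), hs1.tsum_smul_const,
    hs2.tsum_smul_const]

lemma continuousOn_tsum_mul (hsum : Summable fun k => A k * E k)
    (hf : ∀ k, Continuous (f k)) (hh : ∀ k, ContinuousOn (h k) I)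
    (bf : ∀ k x, |f k x| ≤ A k) (bh : ∀ k, ∀ y ∈ I, |h k y| ≤ E k) :
    ContinuousOn (fun p : ℝ × ℝ => ∑' k, f k p.1 * h k p.2) (univ ×ˢ I) :=
  continuousOn_tsum (fun k => ((hf k).comp continuous_fst).continuousOn.mul
    ((hh k).comp continuousOn_snd fun _ hp => hp.2)) hsum
    fun k p hp => abs_mul_le_mul (bf k p.1) (bh k p.2 hp.2)

lemma contDiffOn_one_tsum_mul (hI : IsOpen I) (hI' : IsPreconnected I)
    (hsum : Summable fun k => A k * E k)
    (hf : ∀ k x, HasDerivAt (f k) (f' k x) x) (hh : ∀ k, ∀ y ∈ I, HasDerivAt (h k) (h' k y) y)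
    (cf' : ∀ k, Continuous (f' k)) (ch' : ∀ k, ContinuousOn (h' k) I)
    (bf : ∀ k x, |f k x| ≤ A k) (bf' : ∀ k x, |f' k x| ≤ A k)
    (bh : ∀ k, ∀ y ∈ I, |h k y| ≤ E k) (bh' : ∀ k, ∀ y ∈ I, |h' k y| ≤ E k) :
    ContDiffOn ℝ 1 (fun p : ℝ × ℝ => ∑' k, f k p.1 * h k p.2) (univ ×ˢ I) := by
  have cf : ∀ k, Continuous (f k) := fun k =>
    continuous_iff_continuousAt.2 fun x => (hf k x).continuousAt
  have ch : ∀ k, ContinuousOn (h k) I := fun k y hy => (hh k y hy).continuousAt.continuousWithinAt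
  rw [show (1 : WithTop ℕ∞) = 0 + 1 by norm_num,
    contDiffOn_succ_iff_hasFDerivWithinAt_of_uniqueDiffOn (isOpen_univ.prod hI).uniqueDiffOn]
  refine ⟨by simp, _, ?_, fun p hp =>
    (hasFDerivAt_tsum_mul hI hI' hsum hf hh bf bf' bh bh' p.1 hp.2).hasFDerivWithinAt⟩
  rw [contDiffOn_zero]
  exact ((continuousOn_tsum_mul hsum cf' ch bf' bh).smul continuousOn_const).add
    ((continuousOn_tsum_mul hsum cf ch' bf bh').smul continuousOn_const)

/-- Both partial derivatives are again series of separated functions with the same majorant `A k * E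
k`, so the `C¹` statement applies to each. -/
lemma contDiffOn_two_tsum_mul (hI : IsOpen I) (hI' : IsPreconnected I)
    (hsum : Summable fun k => A k * E k)
    (hf : ∀ k x, HasDerivAt (f k) (f' k x) x) (hh : ∀ k, ∀ y ∈ I, HasDerivAt (h k) (h' k y) y)
    (hf' : ∀ k x, HasDerivAt (f' k) (f'' k x) x)
    (hh' : ∀ k, ∀ y ∈ I, HasDerivAt (h' k) (h'' k y) y)
    (cf'' : ∀ k, Continuous (f'' k)) (ch'' : ∀ k, ContinuousOn (h'' k) I)
    (bf : ∀ k x, |f k x| ≤ A k) (bf' : ∀ k x, |f' k x| ≤ A k) (bf'' : ∀ k x, |f'' k x| ≤ A k)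
    (bh : ∀ k, ∀ y ∈ I, |h k y| ≤ E k) (bh' : ∀ k, ∀ y ∈ I, |h' k y| ≤ E k)
    (bh'' : ∀ k, ∀ y ∈ I, |h'' k y| ≤ E k) :
    ContDiffOn ℝ 2 (fun p : ℝ × ℝ => ∑' k, f k p.1 * h k p.2) (univ ×ˢ I) := by
  have cf' : ∀ k, Continuous (f' k) := fun k =>
    continuous_iff_continuousAt.2 fun x => (hf' k x).continuousAt
  have ch' : ∀ k, ContinuousOn (h' k) I :=
    fun k y hy => (hh' k y hy).continuousAt.continuousWithinAt
  rw [show (2 : WithTop ℕ∞) = 1 + 1 by norm_num,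
    contDiffOn_succ_iff_hasFDerivWithinAt_of_uniqueDiffOn (isOpen_univ.prod hI).uniqueDiffOn]
  refine ⟨by simp, _, ?_, fun p hp =>
    (hasFDerivAt_tsum_mul hI hI' hsum hf hh bf bf' bh bh' p.1 hp.2).hasFDerivWithinAt⟩
  exact ((contDiffOn_one_tsum_mul hI hI' hsum hf' hh cf'' ch' bf' bf'' bh bh').smul
    contDiffOn_const).add ((contDiffOn_one_tsum_mul hI hI' hsum hf hh' cf' ch'' bf bf' bh' bh'').smul
    contDiffOn_const)

lemma iteratedDeriv_two_fst_tsum_mul (hI : IsOpen I) (hI' : IsPreconnected I)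
    (hsum : Summable fun k => A k * E k)
    (hf : ∀ k x, HasDerivAt (f k) (f' k x) x) (hh : ∀ k, ∀ y ∈ I, HasDerivAt (h k) (h' k y) y)
    (hf' : ∀ k x, HasDerivAt (f' k) (f'' k x) x)
    (bf : ∀ k x, |f k x| ≤ A k) (bf' : ∀ k x, |f' k x| ≤ A k) (bf'' : ∀ k x, |f'' k x| ≤ A k)
    (bh : ∀ k, ∀ y ∈ I, |h k y| ≤ E k) (bh' : ∀ k, ∀ y ∈ I, |h' k y| ≤ E k)
    (x : ℝ) {y : ℝ} (hy : y ∈ I) :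
    iteratedDeriv 2 (fun s => ∑' k, f k s * h k y) x = ∑' k, f'' k x * h k y := by
  have hl : ∀ s : ℝ, HasDerivAt (fun s : ℝ => (s, y)) ((1 : ℝ), (0 : ℝ)) s := fun s =>
    (hasDerivAt_id s).prodMk (hasDerivAt_const s y)
  refine iteratedDeriv_two_of_hasDerivAt (p := fun s => ∑' k, f' k s * h k y) Filter.univ_mem
    (fun s _ => ?_) ?_
  · have := (hasFDerivAt_tsum_mul hI hI' hsum hf hh bf bf' bh bh' s hy).comp_hasDerivAt s (hl s)
    simpa [Function.comp_def] using this
  · have := (hasFDerivAt_tsum_mul hI hI' hsum hf' hh bf' bf'' bh bh' x hy).comp_hasDerivAt x (hl x)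
    simpa [Function.comp_def] using this

lemma iteratedDeriv_two_snd_tsum_mul (hI : IsOpen I) (hI' : IsPreconnected I)
    (hsum : Summable fun k => A k * E k)
    (hf : ∀ k x, HasDerivAt (f k) (f' k x) x) (hh : ∀ k, ∀ y ∈ I, HasDerivAt (h k) (h' k y) y)
    (hh' : ∀ k, ∀ y ∈ I, HasDerivAt (h' k) (h'' k y) y)
    (bf : ∀ k x, |f k x| ≤ A k) (bf' : ∀ k x, |f' k x| ≤ A k)
    (bh : ∀ k, ∀ y ∈ I, |h k y| ≤ E k) (bh' : ∀ k, ∀ y ∈ I, |h' k y| ≤ E k)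
    (bh'' : ∀ k, ∀ y ∈ I, |h'' k y| ≤ E k) (x : ℝ) {y : ℝ} (hy : y ∈ I) :
    iteratedDeriv 2 (fun t => ∑' k, f k x * h k t) y = ∑' k, f k x * h'' k y := by
  have hl : ∀ t : ℝ, HasDerivAt (fun t : ℝ => (x, t)) ((0 : ℝ), (1 : ℝ)) t := fun t =>
    (hasDerivAt_const t x).prodMk (hasDerivAt_id t)
  refine iteratedDeriv_two_of_hasDerivAt (p := fun t => ∑' k, f k x * h' k t) (hI.mem_nhds hy)
    (fun t ht => ?_) ?_
  · have := (hasFDerivAt_tsum_mul hI hI' hsum hf hh bf bf' bh bh' x ht).comp_hasDerivAt t (hl t)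
    simpa [Function.comp_def] using this
  · have := (hasFDerivAt_tsum_mul hI hI' hsum hf hh' bf bf' bh' bh'' x hy).comp_hasDerivAt y (hl y)
    simpa [Function.comp_def] using this

end Series

/-! ### Fourier expansion of periodic functions of class `C²` -/

section Fourier

open Complex

lemma norm_fourierCoeffOn_le {f : ℝ → ℂ} {M : ℝ} (hf : ∀ x, ‖f x‖ ≤ M) (k : ℤ) :
    ‖fourierCoeffOn Real.two_pi_pos f k‖ ≤ M := by
  rw [fourierCoeffOn_eq_integral, norm_smul, sub_zero]
  have h : ‖∫ x in (0 : ℝ)..2 * Real.pi, fourier (-k) (x : AddCircle (2 * Real.pi - 0)) • f x‖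
      ≤ M * |2 * Real.pi - 0| := by
    refine intervalIntegral.norm_integral_le_of_norm_le_const fun x _ => ?_
    rw [norm_smul, fourier_apply, Circle.norm_coe, one_mul]
    exact hf x
  rw [sub_zero, abs_of_pos Real.two_pi_pos] at h
  have h2 : ‖1 / (2 * Real.pi)‖ = 1 / (2 * Real.pi) := by
    rw [Real.norm_eq_abs, abs_of_pos (by positivity)]
  rw [h2, div_mul_eq_mul_div, one_mul, div_le_iff₀ Real.two_pi_pos]
  exact h

lemma norm_fourierCoeffOn_eq_div {f f' : ℝ → ℂ} (hf : ∀ x, HasDerivAt f (f' x) x)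
    (hf' : Continuous f') (hper : f (2 * Real.pi) = f 0) {k : ℤ} (hk : k ≠ 0) :
    ‖fourierCoeffOn Real.two_pi_pos f k‖ = ‖fourierCoeffOn Real.two_pi_pos f' k‖ / |(k : ℝ)| := by
  rw [fourierCoeffOn_of_hasDerivAt Real.two_pi_pos hk (fun x _ => hf x)
    (hf'.intervalIntegrable _ _), hper, sub_self, mul_zero, zero_sub, norm_mul, norm_neg, norm_mul,
    norm_div, norm_mul, norm_mul, norm_mul, norm_neg]
  have hk' : |(k : ℝ)| ≠ 0 := by simpa using hk
  simp [abs_of_pos Real.pi_pos]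
  field_simp

/-- Two integrations by parts bound the coefficients by a multiple of `1 / k²`, whence absolute
convergence. The separate bound by `m` depends on the sup norm only; it is the one that enters the
quantitative estimates. -/
theorem exists_fourier_expansion {H : ℝ → ℝ} (hH : ContDiff ℝ 2 H)
    (hp : Function.Periodic H (2 * Real.pi)) {m : ℝ} (hm : ∀ x, |H x| ≤ m) :
    ∃ a b : ℤ → ℝ, (∀ k, |a k| ≤ m) ∧ (∀ k, |b k| ≤ m) ∧ Summable (fun k => |a k| + |b k|) ∧
      ∀ x, HasSum (fun k : ℤ => a k * Real.cos (k * x) + b k * Real.sin (k * x)) (H x) := by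
  have : Fact (0 < 2 * Real.pi) := ⟨Real.two_pi_pos⟩
  set f : ℝ → ℂ := fun x => (H x : ℂ)
  have hd1 : ∀ x, HasDerivAt H (deriv H x) x := fun x =>
    (hH.differentiable (by norm_num) x).hasDerivAt
  have hH1 : ContDiff ℝ 1 (deriv H) := by
    have h2 : ContDiff ℝ (1 + 1) H := by rwa [one_add_one_eq_two]
    exact (contDiff_succ_iff_deriv.1 h2).2.2
  have hd2 : ∀ x, HasDerivAt (deriv H) (deriv (deriv H) x) x := fun x =>
    (hH1.differentiable (by norm_num) x).hasDerivAt
  have hc2 : Continuous (deriv (deriv H)) := hH1.continuous_deriv (by norm_num)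
  have hp1 : Function.Periodic (deriv H) (2 * Real.pi) := fun x => by
    rw [← deriv_comp_add_const]
    exact congrArg (fun g => deriv g x) (funext hp)
  have hp2 : Function.Periodic (deriv (deriv H)) (2 * Real.pi) := fun x => by
    rw [← deriv_comp_add_const]
    exact congrArg (fun g => deriv g x) (funext hp1)
  obtain ⟨M, hM⟩ : ∃ M, ∀ x, |deriv (deriv H) x| ≤ M := by
    have hp2' : Function.Periodic (fun x => |deriv (deriv H) x|) (2 * Real.pi) := fun x => by
      simp only [hp2 x]
    obtain ⟨M, hM⟩ := (hp2'.compact_of_continuous Real.two_pi_pos.ne' hc2.abs).bddAbove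
    exact ⟨M, fun x => hM (mem_range_self x)⟩
  set cf : ℤ → ℂ := fun k => fourierCoeffOn Real.two_pi_pos f k
  have hcf : ∀ k, ‖cf k‖ ≤ m := norm_fourierCoeffOn_le fun x => by simpa [f] using hm x
  have hfp : Function.Periodic f (2 * Real.pi) := fun x => by simp only [f, hp x]
  have hfc : Continuous f := continuous_ofReal.comp hH.continuous
  let G : C(AddCircle (2 * Real.pi), ℂ) := ⟨hfp.lift, hfc.quotient_liftOn' _⟩
  have hG : ∀ x : ℝ, G x = f x := fun x => hfp.lift_coe x
  have hGcf : fourierCoeff G = cf := by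
    ext k
    simp only [cf]
    rw [fourierCoeffOn_eq_integral, fourierCoeff_eq_intervalIntegral _ _ 0]
    simp only [hG, fourier_coe_apply, sub_zero, zero_add]
  have hsum : Summable cf := by
    have hq : Summable fun k : ℤ => M * (1 / (k : ℝ) ^ 2) :=
      (Real.summable_one_div_int_pow.2 one_lt_two).mul_left M
    refine hq.of_norm_bounded_eventually ?_
    filter_upwards [(finite_singleton (0 : ℤ)).compl_mem_cofinite] with k hk
    have hk0 : k ≠ 0 := hk
    simp only [cf]
    rw [norm_fourierCoeffOn_eq_div (f := f) (fun x => (hd1 x).ofReal_comp)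
      (continuous_ofReal.comp hH1.continuous) (by simpa using hfp 0) hk0,
      norm_fourierCoeffOn_eq_div (fun x => (hd2 x).ofReal_comp)
      (continuous_ofReal.comp hc2) (by simpa using hp1 0) hk0, div_div, ← sq, sq_abs,
      div_eq_mul_one_div]
    refine mul_le_mul_of_nonneg_right (norm_fourierCoeffOn_le (fun x => ?_) k) (by positivity)
    simpa using hM x
  -- The real part of each term of the complex series is taken; the sum stays over all integers,
  -- without pairing `k` and `-k`.
  refine ⟨fun k => (cf k).re, fun k => -(cf k).im, fun k => (abs_re_le_norm _).trans (hcf k),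
    fun k => by rw [abs_neg]; exact (abs_im_le_norm _).trans (hcf k), ?_, fun x => ?_⟩
  · refine Summable.of_nonneg_of_le (fun k => by positivity) (fun k => ?_)
      (hsum.norm.add hsum.norm)
    rw [abs_neg]
    exact add_le_add (abs_re_le_norm _) (abs_im_le_norm _)
  · have h := has_pointwise_sum_fourier_series_of_summable (f := G) (hGcf ▸ hsum) x
    rw [hGcf, hG] at h
    have h' := Complex.reCLM.hasSum h
    have hre : Complex.reCLM (f x) = H x := by simp [f]
    rw [hre] at h'
    refine h'.congr_fun ?_
    intro k
    have hexp : (fourier k (x : AddCircle (2 * Real.pi)) : ℂ) = Complex.exp ((k * x : ℝ) * I) := by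
      rw [fourier_coe_apply]
      congr 1
      have : (Real.pi : ℂ) ≠ 0 := by exact_mod_cast Real.pi_ne_zero
      push_cast
      field_simp
    simp only [Complex.reCLM_apply, smul_eq_mul, hexp, Complex.mul_re,
      Complex.exp_ofReal_mul_I_re, Complex.exp_ofReal_mul_I_im]
    ring

end Fourier

/-! ### The Dirichlet problem with data on the upper boundary -/

/-- Interpolation bound for the derivative of a profile. -/
lemma IsProfile.abs_deriv_le {q B B' : ℝ → ℝ} (h : IsProfile q B B') {Q β δ : ℝ} (hδ : 0 < δ)
    (hQ : ∀ y ∈ Icc (-1 : ℝ) 1, |q y| ≤ Q) (hβ : ∀ y ∈ Icc (-1 : ℝ) (1 - δ), |B y| ≤ β)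
    {y : ℝ} (hy : y ∈ Ioo (-1 : ℝ) (1 - 2 * δ)) : |B' y| ≤ (2 / δ + δ * Q) * β := by
  have hsub : Icc y (y + δ) ⊆ Ioo (-1 : ℝ) 1 := fun t ht =>
    ⟨hy.1.trans_le ht.1, by linarith [ht.2, hy.2]⟩
  have hsub' : ∀ t ∈ Icc y (y + δ), |B t| ≤ β := fun t ht =>
    hβ t ⟨(hsub ht).1.le, by linarith [ht.2, hy.2]⟩
  have hyy : y ∈ Icc y (y + δ) := ⟨le_rfl, by linarith⟩
  have hyd : y + δ ∈ Icc y (y + δ) := ⟨by linarith, le_rfl⟩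
  have hQ0 : 0 ≤ Q := (abs_nonneg _).trans (hQ 0 (by norm_num))
  -- The mean value theorem bounds `B'` somewhere in an interval of length `δ`, and `B'' = q B`
  -- bounds its variation there.
  obtain ⟨ξ, hξ, he⟩ := exists_hasDerivAt_eq_slope B B' (show y < y + δ by linarith)
    (h.cont.mono (hsub.trans Ioo_subset_Icc_self))
    fun t ht => h.deriv_fst t (hsub (Ioo_subset_Icc_self ht))
  have h1 : |B' ξ| ≤ 2 / δ * β := by
    rw [he, add_sub_cancel_left, abs_div, abs_of_pos hδ, div_mul_eq_mul_div,
      div_le_div_iff_of_pos_right hδ]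
    linarith [abs_sub (B (y + δ)) (B y), hsub' _ hyy, hsub' _ hyd]
  have h2 : ‖B' y - B' ξ‖ ≤ Q * β * ‖y - ξ‖ :=
    (convex_Icc y (y + δ)).norm_image_sub_le_of_norm_hasDerivWithin_le
      (fun t ht => (h.deriv_snd t (hsub ht)).hasDerivWithinAt)
      (fun t ht => abs_mul_le_mul (hQ t (Ioo_subset_Icc_self (hsub ht))) (hsub' t ht))
      (Ioo_subset_Icc_self hξ) hyy
  have h3 : ‖y - ξ‖ ≤ δ := by
    rw [Real.norm_eq_abs, abs_le]; constructor <;> linarith [hξ.1, hξ.2]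
  have h4 : Q * β * ‖y - ξ‖ ≤ Q * β * δ :=
    mul_le_mul_of_nonneg_left h3 (mul_nonneg hQ0 ((abs_nonneg _).trans (hsub' _ hyy)))
  have h5 : |B' y| ≤ |B' ξ| + |B' y - B' ξ| := by
    have := abs_add_le (B' ξ) (B' y - B' ξ)
    rwa [add_sub_cancel] at this
  rw [Real.norm_eq_abs] at h2
  linarith

lemma summable_one_add_sq_mul_exp {r : ℝ} (hr : 0 < r) :
    Summable fun k : ℤ => (1 + (k : ℝ) ^ 2) * ((1 + (k : ℝ) ^ 2) * Real.exp (-(r * |(k : ℝ)|))) := by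
  have h : Summable fun n : ℕ => (1 + (n : ℝ) ^ 2) * ((1 + (n : ℝ) ^ 2) * Real.exp (-(r * n))) := by
    have h0 := Real.summable_pow_mul_exp_neg_nat_mul 0 hr
    have h2 := Real.summable_pow_mul_exp_neg_nat_mul 2 hr
    have h4 := Real.summable_pow_mul_exp_neg_nat_mul 4 hr
    refine ((h0.add (h2.mul_left 2)).add h4).congr fun n => ?_
    rw [neg_mul]
    ring
  refine Summable.of_nat_of_neg (h.congr fun n => ?_) (h.congr fun n => ?_) <;> simp

lemma hasDerivAt_cos_sin (a b k x : ℝ) :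
    HasDerivAt (fun x => a * Real.cos (k * x) + b * Real.sin (k * x))
      (k * b * Real.cos (k * x) + -(k * a) * Real.sin (k * x)) x := by
  have hk := (hasDerivAt_id x).const_mul k
  exact ((hk.cos.const_mul a).add (hk.sin.const_mul b)).congr_deriv (by simp; ring)

lemma abs_cos_sin_le {a b m : ℝ} (ha : |a| ≤ m) (hb : |b| ≤ m) (x : ℝ) :
    |a * Real.cos x + b * Real.sin x| ≤ 2 * m := by
  have h1 := abs_mul_le_mul ha (Real.abs_cos_le_one x)
  have h2 := abs_mul_le_mul hb (Real.abs_sin_le_one x)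
  linarith [abs_add_le (a * Real.cos x) (b * Real.sin x)]

/-- The Dirichlet problem for `Δ - c(y)` with `C²` data on the upper boundary and zero data on the
lower one is solvable, with `C²` bounds on an inner horizontal line. -/
theorem exists_dirichlet_top {a : ℝ} (ha : 0 < a) (ha' : a < Real.pi / 2) {c : ℝ → ℝ}
    (hc : Continuous c) (hca : ∀ y ∈ Icc (-1 : ℝ) 1, -a ^ 2 < c y) {y₀ : ℝ}
    (hy₀ : y₀ ∈ Ioo (-1 : ℝ) 1) :
    ∃ N : ℝ, ∀ (H : ℝ → ℝ) (m : ℝ), ContDiff ℝ 2 H → Function.Periodic H (2 * Real.pi) →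
      (∀ x, |H x| ≤ m) → ∃ φ : ℝ → ℝ → ℝ, IsClassical φ ∧
        (∀ x, ∀ y ∈ Ioo (-1 : ℝ) 1, lap φ x y = c y * φ x y) ∧
        (∀ x, φ x 1 = H x) ∧ (∀ x, φ x (-1) = 0) ∧
        ∀ x, |φ x y₀| ≤ N * m ∧ |iteratedDeriv 2 (fun s => φ s y₀) x| ≤ N * m := by
  obtain ⟨θ, hθ, C, hC, hdecay⟩ := exists_profile_decay ha ha' hc hca
  have hqc : ∀ k : ℕ, Continuous fun y => (k : ℝ) ^ 2 + c y := fun k => by fun_prop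
  have hqa : ∀ k : ℕ, ∀ y ∈ Icc (-1 : ℝ) 1, -a ^ 2 < (k : ℝ) ^ 2 + c y := fun k y hy => by
    nlinarith [hca y hy]
  choose B B' hB using fun k : ℕ => exists_isProfile ha ha' (hqc k) (hqa k)
  have hBnn : ∀ k, ∀ y ∈ Icc (-1 : ℝ) 1, 0 ≤ B k y := fun k y hy => by
    rcases hy.1.eq_or_lt with rfl | h
    · exact (hB k).bot.ge
    · exact ((hB k).pos ha ha' (hqc k) (hqa k) y ⟨h, hy.2⟩).le
  obtain ⟨M, hM⟩ := (isCompact_Icc (a := (-1 : ℝ)) (b := 1)).exists_bound_of_continuousOn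
    hc.continuousOn
  have hM0 : 0 ≤ M := (norm_nonneg _).trans (hM 0 (by norm_num))
  -- A common majorant of `B`, `B'` and `B''` at heights below `1 - 2δ`. The exponential is the
  -- decay at distance `δ` from the upper wall; the factor `1 + k²` comes from `|k² + c| ≤ k² + M`.
  set E : ℝ → ℤ → ℝ := fun δ k =>
    (2 / δ + 1 + M) * C * ((1 + (k : ℝ) ^ 2) * Real.exp (-(θ * δ * |(k : ℝ)|))) with hEdef
  have hcast : ∀ k : ℤ, ((k.natAbs : ℕ) : ℝ) = |(k : ℝ)| := fun k => by
    rw [Nat.cast_natAbs, Int.cast_abs]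
  have hQ : ∀ k : ℤ, ∀ y ∈ Icc (-1 : ℝ) 1,
      |((k.natAbs : ℕ) : ℝ) ^ 2 + c y| ≤ (k : ℝ) ^ 2 + M := fun k y hy => by
    rw [hcast, sq_abs]
    have := abs_add_le ((k : ℝ) ^ 2) (c y)
    rw [abs_of_nonneg (sq_nonneg (k : ℝ))] at this
    exact this.trans (add_le_add le_rfl (hM y hy))
  have hE : ∀ δ, 0 < δ → δ ≤ 1 → ∀ k : ℤ, ∀ y ∈ Ioo (-1 : ℝ) (1 - 2 * δ),
      |B k.natAbs y| ≤ E δ k ∧ |B' k.natAbs y| ≤ E δ k ∧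
      |(((k.natAbs : ℕ) : ℝ) ^ 2 + c y) * B k.natAbs y| ≤ E δ k := by
    intro δ hδ hδ1 k y hy
    set β := C * Real.exp (-(θ * δ * |(k : ℝ)|)) with hβ
    have hβ0 : 0 ≤ β := by positivity
    have hBβ : ∀ y ∈ Icc (-1 : ℝ) (1 - δ), |B k.natAbs y| ≤ β := fun t ht => by
      have ht' : t ∈ Icc (-1 : ℝ) 1 := ⟨ht.1, by linarith [ht.2]⟩
      rw [abs_of_nonneg (hBnn _ t ht')]
      refine (hdecay _ _ _ (hB k.natAbs) t ht').trans ?_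
      rw [hcast]
      refine mul_le_mul_of_nonneg_left (Real.exp_le_exp.2 ?_) hC.le
      have h0 : 0 ≤ θ * |(k : ℝ)| := by positivity
      nlinarith [ht.2]
    have hy1 : y ∈ Icc (-1 : ℝ) (1 - δ) := ⟨hy.1.le, by linarith [hy.2]⟩
    have hy2 : y ∈ Icc (-1 : ℝ) 1 := ⟨hy.1.le, by linarith [hy.2]⟩
    have hEβ : E δ k = (2 / δ + 1 + M) * (1 + (k : ℝ) ^ 2) * β := by
      simp only [hEdef, hβ]; ring
    have hδ' : 0 < 2 / δ := by positivity
    have hk2 : 0 ≤ (k : ℝ) ^ 2 := sq_nonneg _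
    have hmul : ∀ z, z ≤ (2 / δ + 1 + M) * (1 + (k : ℝ) ^ 2) → z * β ≤ E δ k := fun z hz => by
      rw [hEβ]; exact mul_le_mul_of_nonneg_right hz hβ0
    refine ⟨?_, ?_, ?_⟩
    · refine (hBβ y hy1).trans ?_
      have := hmul 1 (by nlinarith [mul_nonneg hδ'.le hk2, mul_nonneg hM0 hk2])
      rwa [one_mul] at this
    · refine ((hB k.natAbs).abs_deriv_le hδ (hQ k) hBβ hy).trans (hmul _ ?_)
      nlinarith [mul_nonneg hδ'.le hk2, mul_nonneg hM0 hk2,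
        mul_le_mul_of_nonneg_right hδ1 hk2, mul_le_mul_of_nonneg_right hδ1 hM0]
    · refine (abs_mul_le_mul (hQ k y hy2) (hBβ y hy1)).trans (hmul _ ?_)
      nlinarith [mul_nonneg hδ'.le hk2, mul_nonneg hM0 hk2]
  have hsumE : ∀ δ, 0 < δ → Summable fun k : ℤ => (1 + (k : ℝ) ^ 2) * E δ k := fun δ hδ => by
    refine ((summable_one_add_sq_mul_exp (mul_pos hθ hδ)).mul_left
      ((2 / δ + 1 + M) * C)).congr fun k => ?_
    simp only [hEdef]; ring
  -- With `δ = (1 - y₀) / 4` the height `y₀` lies below `1 - 2δ`. The factor `2 (1 + k²)`, times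
  -- `m`, bounds the trigonometric part of mode `k` and its first two derivatives.
  refine ⟨∑' k : ℤ, 2 * ((1 + (k : ℝ) ^ 2) * E ((1 - y₀) / 4) k), fun H m hH hp hm => ?_⟩
  obtain ⟨α, β, hα, hβ, hαβ, hsumH⟩ := exists_fourier_expansion hH hp hm
  have hm0 : 0 ≤ m := (abs_nonneg _).trans (hm 0)
  set f : ℤ → ℝ → ℝ := fun k x => α k * Real.cos (k * x) + β k * Real.sin (k * x) with hf
  set f' : ℤ → ℝ → ℝ := fun k x =>
    k * β k * Real.cos (k * x) + -(k * α k) * Real.sin (k * x) with hf'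
  have df : ∀ k x, HasDerivAt (f k) (f' k x) x := fun k x => hasDerivAt_cos_sin _ _ _ _
  have df' : ∀ k x, HasDerivAt (f' k) (-(k : ℝ) ^ 2 * f k x) x := fun k x =>
    (hasDerivAt_cos_sin _ _ _ _).congr_deriv (by simp only [hf]; ring)
  set A : ℤ → ℝ := fun k => 2 * m * (1 + (k : ℝ) ^ 2) with hA
  have bf0 : ∀ k x, |f k x| ≤ 2 * m := fun k x => abs_cos_sin_le (hα k) (hβ k) _
  have bf : ∀ k x, |f k x| ≤ A k := fun k x => (bf0 k x).trans (by
    simp only [hA]; nlinarith [mul_nonneg hm0 (sq_nonneg (k : ℝ))])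
  have bf'' : ∀ (k : ℤ) x, |-(k : ℝ) ^ 2 * f k x| ≤ A k := fun k x => by
    refine (abs_mul_le_mul (a := (k : ℝ) ^ 2) (by rw [abs_neg, abs_of_nonneg (sq_nonneg _)])
      (bf0 k x)).trans ?_
    simp only [hA]; nlinarith
  have bf' : ∀ k x, |f' k x| ≤ A k := fun k x => by
    have hk : |(k : ℝ)| ≤ 1 + (k : ℝ) ^ 2 := by
      rw [← sq_abs (k : ℝ)]; nlinarith [sq_nonneg (|(k : ℝ)| - 1)]
    refine (abs_cos_sin_le (m := |(k : ℝ)| * m) ?_ ?_ _).trans ?_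
    · exact abs_mul_le_mul le_rfl (hβ k)
    · rw [abs_neg]; exact abs_mul_le_mul le_rfl (hα k)
    · simp only [hA]; nlinarith
  have hsum : ∀ δ, 0 < δ → Summable fun k => A k * E δ k := fun δ hδ =>
    ((hsumE δ hδ).mul_left (2 * m)).congr fun k => by simp only [hA]; ring
  set I : ℝ → Set ℝ := fun δ => Ioo (-1 : ℝ) (1 - 2 * δ) with hI
  have hIsub : ∀ δ, 0 < δ → I δ ⊆ Ioo (-1 : ℝ) 1 := fun δ hδ t ht => ⟨ht.1, by linarith [ht.2]⟩
  have cf : ∀ k, Continuous (f k) := fun k => by simp only [hf]; fun_prop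
  set h : ℤ → ℝ → ℝ := fun k => B k.natAbs with hh
  set h' : ℤ → ℝ → ℝ := fun k => B' k.natAbs with hh'
  set h'' : ℤ → ℝ → ℝ := fun k y => (((k.natAbs : ℕ) : ℝ) ^ 2 + c y) * B k.natAbs y with hh''
  have dh : ∀ δ, 0 < δ → ∀ k, ∀ y ∈ I δ, HasDerivAt (h k) (h' k y) y := fun δ hδ k y hy =>
    (hB k.natAbs).deriv_fst y (hIsub δ hδ hy)
  have dh' : ∀ δ, 0 < δ → ∀ k, ∀ y ∈ I δ, HasDerivAt (h' k) (h'' k y) y := fun δ hδ k y hy =>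
    (hB k.natAbs).deriv_snd y (hIsub δ hδ hy)
  set φ : ℝ → ℝ → ℝ := fun x y => ∑' k, f k x * h k y with hφ
  have hδex : ∀ y ∈ Ioo (-1 : ℝ) 1, 0 < (1 - y) / 4 ∧ (1 - y) / 4 ≤ 1 ∧ y ∈ I ((1 - y) / 4) :=
    fun y hy => ⟨by linarith [hy.2], by linarith [hy.1], hy.1, by linarith [hy.2]⟩
  have hxx : ∀ x, ∀ y ∈ Ioo (-1 : ℝ) 1,
      iteratedDeriv 2 (fun s => φ s y) x = ∑' k : ℤ, -(k : ℝ) ^ 2 * f k x * h k y := by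
    intro x y hy
    obtain ⟨hδ, hδ1, hyI⟩ := hδex y hy
    exact iteratedDeriv_two_fst_tsum_mul isOpen_Ioo isPreconnected_Ioo (hsum _ hδ) df (dh _ hδ)
      df' bf bf' bf'' (fun k t ht => (hE _ hδ hδ1 k t ht).1)
      (fun k t ht => (hE _ hδ hδ1 k t ht).2.1) x hyI
  have hyy : ∀ x, ∀ y ∈ Ioo (-1 : ℝ) 1,
      iteratedDeriv 2 (fun t => φ x t) y = ∑' k, f k x * h'' k y := by
    intro x y hy
    obtain ⟨hδ, hδ1, hyI⟩ := hδex y hy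
    exact iteratedDeriv_two_snd_tsum_mul isOpen_Ioo isPreconnected_Ioo (hsum _ hδ) df (dh _ hδ)
      (dh' _ hδ) bf bf' (fun k t ht => (hE _ hδ hδ1 k t ht).1)
      (fun k t ht => (hE _ hδ hδ1 k t ht).2.1) (fun k t ht => (hE _ hδ hδ1 k t ht).2.2) x hyI
  refine ⟨φ, ⟨?_, ?_, ?_⟩, ?_, ?_, ?_, ?_⟩
  · intro x y _
    refine tsum_congr fun k => ?_
    have hk : (k : ℝ) * (x + 2 * Real.pi) = k * x + k * (2 * Real.pi) := by ring
    simp only [hf, hk, Real.cos_add_int_mul_two_pi, Real.sin_add_int_mul_two_pi]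
  · rintro ⟨x, y⟩ ⟨-, hy⟩
    obtain ⟨hδ, hδ1, hyI⟩ := hδex y hy
    refine (ContDiffOn.contDiffAt (s := univ ×ˢ I ((1 - y) / 4)) ?_
      ((isOpen_univ.prod isOpen_Ioo).mem_nhds ⟨mem_univ _, hyI⟩)).contDiffWithinAt
    refine contDiffOn_two_tsum_mul isOpen_Ioo isPreconnected_Ioo (hsum _ hδ) df (dh _ hδ)
      df' (dh' _ hδ) (fun k => continuous_const.mul (cf k)) (fun k => ?_) bf bf' bf''
      (fun k t ht => (hE _ hδ hδ1 k t ht).1) (fun k t ht => (hE _ hδ hδ1 k t ht).2.1)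
      (fun k t ht => (hE _ hδ hδ1 k t ht).2.2)
    exact (hqc k.natAbs).continuousOn.mul
      ((hB k.natAbs).cont.mono ((hIsub _ hδ).trans Ioo_subset_Icc_self))
  -- At the upper wall the exponential gain is lost: only `0 ≤ B ≤ C` remains, and summability of
  -- the coefficients takes over.
  · refine continuousOn_tsum_mul (A := fun k => |α k| + |β k|) (E := fun _ => C)
      (hαβ.mul_right C) cf (fun k => (hB k.natAbs).cont) (fun k x => ?_) (fun k y hy => ?_)
    · have h1 := abs_mul_le_mul (le_refl |α k|) (Real.abs_cos_le_one (k * x))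
      have h2 := abs_mul_le_mul (le_refl |β k|) (Real.abs_sin_le_one (k * x))
      simp only [hf]
      linarith [abs_add_le (α k * Real.cos (k * x)) (β k * Real.sin (k * x))]
    · simp only [hh]
      rw [abs_of_nonneg (hBnn _ y hy)]
      refine (hdecay _ _ _ (hB k.natAbs) y hy).trans (mul_le_of_le_one_right hC.le ?_)
      refine Real.exp_le_one_iff.2 (neg_nonpos.2 ?_)
      have : 0 ≤ 1 - y := by linarith [hy.2]
      positivity
  · intro x y hy
    obtain ⟨hδ, hδ1, hyI⟩ := hδex y hy
    have s1 : Summable fun k : ℤ => -(k : ℝ) ^ 2 * f k x * h k y :=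
      .of_norm_bounded (hsum _ hδ) fun k => abs_mul_le_mul (bf'' k x) (hE _ hδ hδ1 k y hyI).1
    have s2 : Summable fun k => f k x * h'' k y :=
      .of_norm_bounded (hsum _ hδ) fun k => abs_mul_le_mul (bf k x) (hE _ hδ hδ1 k y hyI).2.2
    rw [lap, hxx x y hy, hyy x y hy, ← s1.tsum_add s2, hφ, ← tsum_mul_left]
    refine tsum_congr fun k => ?_
    simp only [hh'', hh, hcast, sq_abs]
    ring
  · intro x
    simp only [hφ, hh, (hB _).top, mul_one]
    exact (hsumH x).tsum_eq
  · intro x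
    simp only [hφ, hh, (hB _).bot, mul_zero, tsum_zero]
  · intro x
    obtain ⟨hδ, hδ1, hyI⟩ := hδex y₀ hy₀
    have hN : (∑' k : ℤ, 2 * ((1 + (k : ℝ) ^ 2) * E ((1 - y₀) / 4) k)) * m
        = ∑' k, A k * E ((1 - y₀) / 4) k := by
      rw [← tsum_mul_right]
      exact tsum_congr fun k => by simp only [hA]; ring
    rw [hN, hxx x y₀ hy₀]
    exact ⟨tsum_of_norm_bounded (f := fun k : ℤ => f k x * h k y₀) (hsum _ hδ).hasSum fun k =>
        abs_mul_le_mul (bf k x) (hE _ hδ hδ1 k y₀ hyI).1,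
      tsum_of_norm_bounded (f := fun k : ℤ => -(k : ℝ) ^ 2 * f k x * h k y₀) (hsum _ hδ).hasSum
        fun k => abs_mul_le_mul (bf'' k x) (hE _ hδ hδ1 k y₀ hyI).1⟩

/-! ### Steady states are shear flows -/

/-- The mode `cos (π y / 2)` is an eigenfunction. The upper bound alone is enough to turn the
stability hypothesis into `F' > -(π/2)²`. Boundedness below of the spectrum need not be shown, as
`sInf` would otherwise be 0. -/
lemma firstDirichletEigenvalue_le : firstDirichletEigenvalue ≤ (Real.pi / 2) ^ 2 := by
  unfold firstDirichletEigenvalue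
  by_cases hb : BddBelow {μ | IsDirichletEigenvalue μ}
  · refine csInf_le hb ⟨fun _ y => Real.cos (Real.pi / 2 * y), ?_, ?_, ?_, ?_, ?_⟩
    · exact IsClassical.of_snd (by fun_prop) (by fun_prop)
    · exact ⟨0, 0, by norm_num, by simp⟩
    · intro x y _
      rw [lap_snd, iteratedDeriv_two_cos_mul]
      ring
    · simp
    · simp
  · rw [Real.sInf_of_not_bddBelow hb]
    positivity

/-- On a bounded range of the stream function, `F'` stays uniformly above minus the first
eigenvalue. -/
lemma exists_stability_constant {F : ℝ → ℝ} (hF : Continuous (deriv F))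
    (hstable : ∀ s, -firstDirichletEigenvalue < deriv F s) {R : ℝ} (hR : 0 ≤ R) :
    ∃ a : ℝ, 0 < a ∧ a < Real.pi / 2 ∧ ∀ s ∈ Icc (-R) R, -a ^ 2 < deriv F s := by
  obtain ⟨s₀, -, hmin⟩ := (isCompact_Icc (a := -R) (b := R)).exists_isMinOn
    ⟨0, by constructor <;> linarith⟩ hF.continuousOn
  have h0 : -(Real.pi / 2) ^ 2 < deriv F s₀ := by
    linarith [hstable s₀, firstDirichletEigenvalue_le]
  have hpi : 0 < (Real.pi / 2) ^ 2 := by positivity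
  have hm : max (-deriv F s₀) 0 < (Real.pi / 2) ^ 2 := max_lt (by linarith) hpi
  have hm0 : 0 ≤ max (-deriv F s₀) 0 := le_max_right _ _
  have hm1 : -deriv F s₀ ≤ max (-deriv F s₀) 0 := le_max_left _ _
  -- `a²` is the midpoint between `max (-min F') 0` and `(π/2)²`.
  refine ⟨√((max (-deriv F s₀) 0 + (Real.pi / 2) ^ 2) / 2), Real.sqrt_pos.2 (by linarith), ?_,
    fun s hs => ?_⟩
  · rw [Real.sqrt_lt' (by positivity)]
    linarith
  · rw [Real.sq_sqrt (by linarith)]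
    have : deriv F s₀ ≤ deriv F s := hmin hs
    linarith

lemma exists_slope_eq_deriv {F : ℝ → ℝ} (hF : Differentiable ℝ F) {R s t : ℝ}
    (hs : s ∈ Icc (-R) R) (ht : t ∈ Icc (-R) R) :
    ∃ ξ ∈ Icc (-R) R, F t - F s = deriv F ξ * (t - s) := by
  rcases lt_trichotomy s t with h | rfl | h
  · obtain ⟨ξ, hξ, he⟩ := exists_deriv_eq_slope F h hF.continuous.continuousOn hF.differentiableOn
    refine ⟨ξ, ⟨hs.1.trans hξ.1.le, hξ.2.le.trans ht.2⟩, ?_⟩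
    rw [he, div_mul_cancel₀ _ (sub_ne_zero.2 h.ne')]
  · exact ⟨s, hs, by simp⟩
  · obtain ⟨ξ, hξ, he⟩ := exists_deriv_eq_slope F h hF.continuous.continuousOn hF.differentiableOn
    refine ⟨ξ, ⟨ht.1.trans hξ.1.le, hξ.2.le.trans hs.2⟩, ?_⟩
    have := sub_ne_zero.2 h.ne'
    rw [he]
    field_simp
    ring

section SteadyState

variable {F : ℝ → ℝ} {cG cH : ℝ} {ψ : ℝ → ℝ → ℝ}

lemma IsSteadyState.isClassical (hψ : IsSteadyState F cG cH ψ) : IsClassical ψ :=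
  ⟨hψ.1, hψ.2.1.mono (prod_mono_right Ioo_subset_Icc_self), hψ.2.1.continuousOn⟩

lemma IsClassical.exists_bound {u : ℝ → ℝ → ℝ} (hu : IsClassical u) :
    ∃ R, 0 ≤ R ∧ ∀ x, ∀ y ∈ Icc (-1 : ℝ) 1, u x y ∈ Icc (-R) R := by
  obtain ⟨R, hR⟩ := (isCompact_Icc (a := 0) (b := 2 * Real.pi)).prod
    (isCompact_Icc (a := (-1 : ℝ)) (b := 1)) |>.exists_bound_of_continuousOn
    (hu.2.2.mono (prod_mono_left (subset_univ _)))
  have key : ∀ x, ∀ y ∈ Icc (-1 : ℝ) 1, |u x y| ≤ R := fun x y hy => by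
    have hper : Function.Periodic (fun s => u s y) (2 * Real.pi) := fun s => hu.1 s y hy
    obtain ⟨s, hs, he⟩ := hper.exists_mem_Ico₀ Real.two_pi_pos x
    have h1 : u x y = u s y := he
    rw [h1]
    exact hR (s, y) ⟨⟨hs.1, hs.2.le⟩, hy⟩
  exact ⟨R, (abs_nonneg _).trans (key 0 0 (by norm_num)), fun x y hy => abs_le.1 (key x y hy)⟩

/-- A stable steady state is a shear flow, and the potential `F'(ψ)` of the linearized problem is
a continuous function of the height above minus the first eigenvalue. -/
theorem IsSteadyState.exists_potential (hψ : IsSteadyState F cG cH ψ) (hF : ContDiff ℝ 4 F)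
    (hstable : ∀ s, -firstDirichletEigenvalue < deriv F s) :
    (∀ x, ∀ y ∈ Icc (-1 : ℝ) 1, ψ x y = ψ 0 y) ∧
    ∃ a : ℝ, 0 < a ∧ a < Real.pi / 2 ∧ ∃ c : ℝ → ℝ, Continuous c ∧
      (∀ y ∈ Icc (-1 : ℝ) 1, -a ^ 2 < c y) ∧
      ∀ x, ∀ y ∈ Icc (-1 : ℝ) 1, deriv F (ψ x y) = c y := by
  have hFd : Differentiable ℝ F := hF.differentiable (by norm_num)
  have hFc : Continuous (deriv F) := hF.continuous_deriv (by norm_num)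
  have hcl := hψ.isClassical
  obtain ⟨R, hR, hrange⟩ := hcl.exists_bound
  obtain ⟨a, ha, ha', hstab⟩ := exists_stability_constant hFc hstable hR
  have hshear : ∀ x, ∀ y ∈ Icc (-1 : ℝ) 1, ψ x y = ψ 0 y := by
    intro s y hy
    -- The potential is a value of `F'` from the mean value theorem, chosen pointwise; the maximum
    -- principle needs only its lower bound.
    have hslope : ∀ x y, ∃ q, y ∈ Ioo (-1 : ℝ) 1 →
        -a ^ 2 < q ∧ F (ψ (x + s) y) - F (ψ x y) = q * (ψ (x + s) y - ψ x y) := fun x y => by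
      by_cases hy : y ∈ Ioo (-1 : ℝ) 1
      · obtain ⟨ξ, hξ, he⟩ := exists_slope_eq_deriv hFd
          (hrange x y (Ioo_subset_Icc_self hy)) (hrange (x + s) y (Ioo_subset_Icc_self hy))
        exact ⟨deriv F ξ, fun _ => ⟨hstab ξ hξ, he⟩⟩
      · exact ⟨0, fun h => absurd h hy⟩
    choose q hq using hslope
    have := eq_zero_of_dirichlet ha ha' ((hcl.translate s).sub hcl) (q := q)
      (fun x y hy => (hq x y hy).1)
      (fun x y hy => by
        rw [(hcl.translate s).lap_sub hcl x hy, lap_translate, hψ.2.2.1 _ y hy, hψ.2.2.1 _ y hy,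
          (hq x y hy).2])
      (fun x => by rw [hψ.2.2.2.1, hψ.2.2.2.1, sub_self])
      (fun x => by rw [hψ.2.2.2.2, hψ.2.2.2.2, sub_self]) 0 y hy
    rw [zero_add] at this
    exact sub_eq_zero.1 this
  -- Projecting the height to `[-1, 1]` makes the potential continuous on the whole line.
  refine ⟨hshear, a, ha, ha', fun y => deriv F (ψ 0 (projIcc (-1 : ℝ) 1 (by norm_num) y)), ?_,
    fun y _ => hstab _ (hrange 0 _ (Subtype.prop _)), fun x y hy => ?_⟩
  · refine hFc.comp (hcl.2.2.comp_continuous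
      (f := fun y : ℝ => ((0 : ℝ), (projIcc (-1 : ℝ) 1 (by norm_num) y : ℝ))) ?_ ?_)
    · exact continuous_const.prodMk (continuous_subtype_val.comp continuous_projIcc)
    · exact fun y => ⟨mem_univ _, Subtype.prop _⟩
  · simp only [projIcc_of_mem _ hy, hshear x y hy]

lemma dy_eq_of_shear (hshear : ∀ x, ∀ y ∈ Icc (-1 : ℝ) 1, ψ x y = ψ 0 y) (x : ℝ) {y : ℝ}
    (hy : y ∈ Icc (-1 : ℝ) 1) : dy ψ x y = dy ψ 0 y :=
  derivWithin_congr (fun t ht => hshear x t ht) (hshear x y hy)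

/-- A nonconstant stable shear flow does not stagnate on both walls. -/
theorem IsSteadyState.dy_ne_zero (hψ : IsSteadyState F cG cH ψ) (hF : ContDiff ℝ 4 F)
    (hnc : IsNonconstant ψ) (hshear : ∀ x, ∀ y ∈ Icc (-1 : ℝ) 1, ψ x y = ψ 0 y)
    {a : ℝ} (ha : 0 < a) (ha' : a < Real.pi / 2) {c : ℝ → ℝ} (hc : Continuous c)
    (hca : ∀ y ∈ Icc (-1 : ℝ) 1, -a ^ 2 < c y)
    (hcF : ∀ x, ∀ y ∈ Icc (-1 : ℝ) 1, deriv F (ψ x y) = c y) :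
    dy ψ 0 1 ≠ 0 ∨ dy ψ 0 (-1) ≠ 0 := by
  by_contra! hdy
  set Ψ : ℝ → ℝ := fun y => ψ 0 y with hΨ
  set p : ℝ → ℝ := fun y => dy ψ 0 y with hp
  have hud : UniqueDiffOn ℝ (Icc (-1 : ℝ) 1) := uniqueDiffOn_Icc (by norm_num)
  have hΨ2 : ContDiffOn ℝ 2 Ψ (Icc (-1) 1) :=
    hψ.2.1.comp (f := fun y : ℝ => ((0 : ℝ), y)) (contDiff_const.prodMk contDiff_id).contDiffOn
      fun y hy => ⟨mem_univ _, hy⟩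
  have hpc : ContinuousOn p (Icc (-1) 1) :=
    hΨ2.continuousOn_derivWithin hud (by norm_num)
  have hΨd : DifferentiableOn ℝ Ψ (Icc (-1) 1) := hΨ2.differentiableOn (by norm_num)
  have d1 : ∀ y ∈ Ioo (-1 : ℝ) 1, HasDerivAt Ψ (p y) y := fun y hy =>
    (hΨd y (Ioo_subset_Icc_self hy)).hasDerivWithinAt.hasDerivAt (Icc_mem_nhds hy.1 hy.2)
  have d2 : ∀ y ∈ Ioo (-1 : ℝ) 1, HasDerivAt p (F (Ψ y)) y := fun y hy => by
    have heq : deriv Ψ =ᶠ[𝓝 y] p := by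
      filter_upwards [isOpen_Ioo.mem_nhds hy] with t ht using (d1 t ht).deriv
    have hdd : DifferentiableAt ℝ (deriv Ψ) y := by
      have h2 : ContDiffOn ℝ (1 + 1) Ψ (Ioo (-1) 1) := by
        rw [one_add_one_eq_two]; exact hΨ2.mono Ioo_subset_Icc_self
      exact (((contDiffOn_succ_iff_deriv_of_isOpen isOpen_Ioo).1 h2).2.2.contDiffAt
        (isOpen_Ioo.mem_nhds hy)).differentiableAt (by norm_num)
    have hlap := hψ.2.2.1 0 y hy
    have hconst : (fun s => ψ s y) = fun _ => ψ 0 y :=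
      funext fun s => hshear s y (Ioo_subset_Icc_self hy)
    rw [lap, hconst, iteratedDeriv_const, if_neg two_ne_zero, zero_add, iteratedDeriv_succ,
      iteratedDeriv_one] at hlap
    have := hdd.hasDerivAt
    rw [hlap] at this
    exact this.congr_of_eventuallyEq heq.symm
  -- Differentiating `Ψ'' = F(Ψ)` gives `p'' = c p` for `p = Ψ'`, so vanishing of `p` at both walls
  -- forces `p = 0`.
  have d3 : ∀ y ∈ Ioo (-1 : ℝ) 1, HasDerivAt (fun y => F (Ψ y)) (c y * p y) y := fun y hy => by
    have := ((hF.differentiable (by norm_num)) (Ψ y)).hasDerivAt.comp y (d1 y hy)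
    rwa [hΨ, hcF 0 y (Ioo_subset_Icc_self hy)] at this
  have hpcd : ContDiffOn ℝ 2 p (Ioo (-1) 1) := contDiffOn_two_of_hasDerivAt isOpen_Ioo d2 d3
    (hc.continuousOn.mul (hpc.mono Ioo_subset_Icc_self))
  have hp0 := eq_zero_of_dirichlet ha ha' (IsClassical.of_snd hpcd hpc) (q := fun _ y => c y)
    (fun _ y hy => hca y (Ioo_subset_Icc_self hy))
    (fun x y hy => by
      rw [lap_snd, iteratedDeriv_two_of_hasDerivAt (isOpen_Ioo.mem_nhds hy) d2 (d3 y hy)])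
    (fun _ => hdy.1) (fun _ => hdy.2) 0
  have hconst := constant_of_derivWithin_zero hΨd fun y hy => hp0 y (Ico_subset_Icc_self hy)
  obtain ⟨x, y, hy, x', y', hy', hne⟩ := hnc
  exact hne (by rw [hshear x y hy, hshear x' y' hy']; exact (hconst y hy).trans (hconst y' hy').symm)

end SteadyState

/-! ### Periodic functions whose maxima are nondegenerate and nonzero -/

/-- The maximum of `u` is nonzero, and all its global maximizers are nondegenerate. -/
def HasNondegenerateMax (u : ℝ → ℝ) : Prop :=
  (⨆ x, u x) ≠ 0 ∧ ∀ x₀, (∀ x, u x ≤ u x₀) → iteratedDeriv 2 u x₀ < 0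

lemma exists_forall_le_of_periodic {u : ℝ → ℝ} (hu : Continuous u)
    (hp : Function.Periodic u (2 * Real.pi)) : ∃ x₀, ∀ x, u x ≤ u x₀ := by
  obtain ⟨x₀, -, hx₀⟩ := (isCompact_Icc (a := 0) (b := 2 * Real.pi)).exists_isMaxOn
    ⟨0, by simp [Real.pi_pos.le]⟩ hu.continuousOn
  refine ⟨x₀, fun x => ?_⟩
  obtain ⟨s, hs, he⟩ := hp.exists_mem_Ico₀ Real.two_pi_pos x
  rw [he]
  exact hx₀ ⟨hs.1, hs.2.le⟩

lemma iSup_eq_of_forall_le {u : ℝ → ℝ} {x₀ : ℝ} (h : ∀ x, u x ≤ u x₀) : ⨆ x, u x = u x₀ :=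
  le_antisymm (ciSup_le h) (le_ciSup (f := u) ⟨u x₀, by rintro _ ⟨x, rfl⟩; exact h x⟩ x₀)

lemma periodic_iteratedDeriv_of_periodic {u : ℝ → ℝ} {T : ℝ} (hp : Function.Periodic u T) (k : ℕ) :
    Function.Periodic (iteratedDeriv k u) T := fun x => by
  rw [← congrFun (iteratedDeriv_comp_add_const k u T) x]
  exact congrArg (fun g => iteratedDeriv k g x) (funext hp)

/-- Nondegeneracy of the maxima is stable under `C²`-small perturbations. -/
theorem HasNondegenerateMax.exists_stable {u : ℝ → ℝ} (hu : ContDiff ℝ 2 u)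
    (hp : Function.Periodic u (2 * Real.pi)) (h : HasNondegenerateMax u) :
    ∃ ε > 0, ∀ v : ℝ → ℝ, ContDiff ℝ 2 v → Function.Periodic v (2 * Real.pi) →
      (∀ x, |v x| ≤ ε) → (∀ x, |iteratedDeriv 2 v x| ≤ ε) →
      HasNondegenerateMax (fun x => u x + v x) := by
  obtain ⟨z, hz⟩ := exists_forall_le_of_periodic hu.continuous hp
  have hM : u z ≠ 0 := by rw [← iSup_eq_of_forall_le hz]; exact h.1
  have hc2 : Continuous (iteratedDeriv 2 u) := hu.continuous_iteratedDeriv 2 (by norm_num)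
  have hp2 := periodic_iteratedDeriv_of_periodic hp 2
  -- The minimum `η` over `x` of `max (u z - u x) (-u'' x)` is positive by nondegeneracy: each point
  -- is either below the maximum by `η` or concave by `η`.
  have hmin : ∃ w, ∀ x, -max (u z - u x) (-iteratedDeriv 2 u x) ≤
      -max (u z - u w) (-iteratedDeriv 2 u w) :=
    exists_forall_le_of_periodic (u := fun x => -max (u z - u x) (-iteratedDeriv 2 u x))
      (((continuous_const.sub hu.continuous).max hc2.neg).neg)
      fun x => by simp only [hp x, hp2 x]
  obtain ⟨w, hw⟩ := hmin
  set η := max (u z - u w) (-iteratedDeriv 2 u w) with hη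
  have hη0 : 0 < η := by
    by_contra! hle
    have h1 : u z - u w ≤ 0 := (le_max_left _ _).trans hle
    have h2 : -iteratedDeriv 2 u w ≤ 0 := (le_max_right _ _).trans hle
    have := h.2 w fun x => (hz x).trans (by linarith)
    linarith
  have hM' : 0 < |u z| := abs_pos.2 hM
  -- At a maximizer of `u + v` the deficit of `u` is at most `2η/3 < η`, so `u'' ≤ -η` there and
  -- `v''` cannot compensate. The bound `|u z| / 2` keeps the sign of the maximum.
  refine ⟨min (η / 3) (|u z| / 2), by positivity, fun v hv hvp hv0 hv2 => ?_⟩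
  have hv0' : ∀ x, |v x| ≤ η / 3 := fun x => (hv0 x).trans (min_le_left _ _)
  have hv0'' : ∀ x, |v x| ≤ |u z| / 2 := fun x => (hv0 x).trans (min_le_right _ _)
  have hv2' : ∀ x, |iteratedDeriv 2 v x| ≤ η / 3 := fun x => (hv2 x).trans (min_le_left _ _)
  constructor
  · obtain ⟨x₀, hx₀⟩ := exists_forall_le_of_periodic (u := fun x => u x + v x)
      (hu.continuous.add hv.continuous) fun x => by simp only [hp x, hvp x]
    rw [iSup_eq_of_forall_le hx₀]
    intro h0
    have h1 := hx₀ z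
    have h2 := hz x₀
    simp only [h0] at h1
    have h3 := abs_le.1 (hv0'' x₀)
    have h4 := abs_le.1 (hv0'' z)
    rcases lt_or_gt_of_ne hM with hneg | hpos
    · rw [abs_of_neg hneg] at h3; linarith
    · rw [abs_of_pos hpos] at h4; linarith
  · intro x₀ hx₀
    have h1 := hx₀ z
    have h2 := abs_le.1 (hv0' x₀)
    have h3 := abs_le.1 (hv0' z)
    have h4 := abs_le.1 (hv2' x₀)
    rw [iteratedDeriv_fun_add hu.contDiffAt hv.contDiffAt]
    have h5 : η ≤ max (u z - u x₀) (-iteratedDeriv 2 u x₀) := neg_le_neg_iff.1 (hw x₀)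
    rcases le_max_iff.1 h5 with h6 | h6
    · simp only at h1; linarith
    · linarith

lemma iteratedDeriv_two_cos_sub (r z x : ℝ) :
    iteratedDeriv 2 (fun x => r * Real.cos (x - z)) x = -(r * Real.cos (x - z)) := by
  have h1 : ∀ x, HasDerivAt (fun x => r * Real.cos (x - z)) (-(r * Real.sin (x - z))) x := fun x =>
    (((hasDerivAt_id x).sub_const z).cos.const_mul r).congr_deriv (by simp)
  have h2 : HasDerivAt (fun x => -(r * Real.sin (x - z))) (-(r * Real.cos (x - z))) x :=
    (((hasDerivAt_id x).sub_const z).sin.const_mul r).neg.congr_deriv (by simp)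
  exact iteratedDeriv_two_of_hasDerivAt Filter.univ_mem (fun x _ => h1 x) h2

/-- Adding a positive multiple of a cosine centred at a maximizer makes the maximum
nondegenerate. -/
lemma hasNondegenerateMax_add_cos {u : ℝ → ℝ} (hu : ContDiff ℝ 2 u) {z r : ℝ}
    (hz : ∀ x, u x ≤ u z) (hr : 0 < r) (h0 : u z + r ≠ 0) :
    HasNondegenerateMax (fun x => u x + r * Real.cos (x - z)) := by
  have hmax : ∀ x, u x + r * Real.cos (x - z) ≤ u z + r * Real.cos (z - z) := fun x => by
    rw [sub_self, Real.cos_zero]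
    nlinarith [hz x, Real.cos_le_one (x - z)]
  constructor
  · rw [iSup_eq_of_forall_le hmax]
    simpa using h0
  · intro x₀ hx₀
    have h1 := hx₀ z
    simp only [sub_self, Real.cos_zero, mul_one] at h1
    have h2 : r * Real.cos (x₀ - z) ≤ r :=
      mul_le_of_le_one_right hr.le (Real.cos_le_one _)
    -- Both summands are maximal at `z`, so a maximizer of the sum maximizes each; the cosine then
    -- contributes `-r` to a second derivative already `≤ 0`.
    have h3 : u x₀ = u z := le_antisymm (hz x₀) (by linarith)
    have h4 : r * Real.cos (x₀ - z) = r := le_antisymm h2 (by linarith)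
    rw [iteratedDeriv_fun_add hu.contDiffAt (by fun_prop), iteratedDeriv_two_cos_sub, h4]
    have h5 : iteratedDeriv 2 u x₀ ≤ 0 := iteratedDeriv_two_nonpos_of_isLocalMax
      (Filter.Eventually.of_forall fun x => h3 ▸ hz x) hu.continuous.continuousAt
    linarith

/-! ### Elements of the Hölder space -/

namespace HolderC2

variable {α : ℝ}

lemma abs_apply_le_norm (f : HolderC2 α) (x : ℝ) : |f x| ≤ ‖f‖ := by
  have h0 := le_ciSup (f.bddAbove_deriv (k := 0) (by norm_num)) x
  rw [iteratedDeriv_zero] at h0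
  have h1 := supDeriv_nonneg 1 (f : ℝ → ℝ)
  have h2 := supDeriv_nonneg 2 (f : ℝ → ℝ)
  have h3 := holderSeminorm_nonneg (α := α) (f : ℝ → ℝ)
  rw [norm_def, holderNorm]
  change |f x| ≤ supDeriv 0 f at h0
  linarith

/-- The Lipschitz bound serves for `|x - y| ≤ 1`, the trivial bound 2 beyond. -/
lemma abs_cos_sub_cos_le (hα : α ∈ Ioo (0 : ℝ) 1) (x y : ℝ) :
    |Real.cos x - Real.cos y| ≤ 2 * |x - y| ^ α := by
  rcases le_total |x - y| 1 with h | h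
  · have h1 : |Real.cos x - Real.cos y| ≤ |x - y| := by
      have := Real.lipschitzWith_cos.dist_le_mul x y
      simpa [Real.dist_eq] using this
    have h2 : |x - y| ≤ |x - y| ^ α := by
      rcases (abs_nonneg (x - y)).eq_or_lt with h0 | h0
      · rw [← h0]; exact Real.rpow_nonneg le_rfl _
      · conv_lhs => rw [← Real.rpow_one |x - y|]
        exact Real.rpow_le_rpow_of_exponent_ge h0 h hα.2.le
    linarith [abs_nonneg (x - y)]
  · have h1 : 1 ≤ |x - y| ^ α := Real.one_le_rpow h hα.1.le
    have h2 : |Real.cos x - Real.cos y| ≤ 2 := by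
      rw [abs_le]
      constructor <;> linarith [Real.cos_le_one x, Real.cos_le_one y, Real.neg_one_le_cos x,
        Real.neg_one_le_cos y]
    linarith

/-- The function `r cos(x - z)` as an element of `C^{2,α}`. -/
noncomputable def cosine (hα : α ∈ Ioo (0 : ℝ) 1) (r z : ℝ) : HolderC2 α :=
  ⟨fun x => r * Real.cos (x - z), by fun_prop,
    fun x => by
      simp only [show x + 2 * Real.pi - z = x - z + 2 * Real.pi by ring, Real.cos_add_two_pi],
    2 * |r|, fun x y => by
      rw [iteratedDeriv_two_cos_sub, iteratedDeriv_two_cos_sub,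
        show -(r * Real.cos (x - z)) - -(r * Real.cos (y - z))
          = -(r * (Real.cos (x - z) - Real.cos (y - z))) by ring, abs_neg, abs_mul]
      have := abs_cos_sub_cos_le hα (x - z) (y - z)
      rw [sub_sub_sub_cancel_right] at this
      nlinarith [abs_nonneg r]⟩

/-- Three sup norms contribute `|r|` each and the Hölder seminorm `2 |r|`, uniformly in the phase
`z`. -/
lemma norm_cosine_le (hα : α ∈ Ioo (0 : ℝ) 1) (r z : ℝ) : ‖cosine hα r z‖ ≤ 5 * |r| := by
  have hcoe : (cosine hα r z : ℝ → ℝ) = fun x => r * Real.cos (x - z) := rfl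
  have hcos : ∀ x, |r * Real.cos x| ≤ |r| := fun x => by
    simpa using abs_mul_le_mul (le_refl |r|) (Real.abs_cos_le_one x)
  have hsin : ∀ x, |r * Real.sin x| ≤ |r| := fun x => by
    simpa using abs_mul_le_mul (le_refl |r|) (Real.abs_sin_le_one x)
  have h0 : supDeriv 0 (fun x => r * Real.cos (x - z)) ≤ |r| := ciSup_le fun x => by
    rw [iteratedDeriv_zero]; exact hcos _
  have h1 : supDeriv 1 (fun x => r * Real.cos (x - z)) ≤ |r| := ciSup_le fun x => by
    have : HasDerivAt (fun x => r * Real.cos (x - z)) (-(r * Real.sin (x - z))) x :=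
      (((hasDerivAt_id x).sub_const z).cos.const_mul r).congr_deriv (by simp)
    rw [iteratedDeriv_one, this.deriv, abs_neg]
    exact hsin _
  have h2 : supDeriv 2 (fun x => r * Real.cos (x - z)) ≤ |r| := ciSup_le fun x => by
    rw [iteratedDeriv_two_cos_sub, abs_neg]; exact hcos _
  have h3 : holderSeminorm α (fun x => r * Real.cos (x - z)) ≤ 2 * |r| := ciSup_le fun p => by
    rw [iteratedDeriv_two_cos_sub, iteratedDeriv_two_cos_sub,
      show -(r * Real.cos (p.1 - z)) - -(r * Real.cos (p.2 - z))
        = -(r * (Real.cos (p.1 - z) - Real.cos (p.2 - z))) by ring, abs_neg, abs_mul]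
    have := abs_cos_sub_cos_le hα (p.1 - z) (p.2 - z)
    rw [sub_sub_sub_cancel_right] at this
    refine div_le_of_le_mul₀ (Real.rpow_nonneg (abs_nonneg _) _) (by positivity) ?_
    nlinarith [abs_nonneg r]
  rw [norm_def, hcoe, holderNorm]
  linarith

end HolderC2

/-! ### First order corrections -/

section FirstCorrection

variable {F : ℝ → ℝ} {ψ : ℝ → ℝ → ℝ}

lemma IsFirstCorrection.add {g₁ h₁ g₂ h₂ : ℝ → ℝ} {φ₁ φ₂ : ℝ → ℝ → ℝ}
    (H₁ : IsFirstCorrection F ψ g₁ h₁ φ₁) (H₂ : IsFirstCorrection F ψ g₂ h₂ φ₂) :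
    IsFirstCorrection F ψ (g₁ + g₂) (h₁ + h₂) (fun x y => φ₁ x y + φ₂ x y) := by
  refine ⟨H₁.1.add H₂.1, fun x y hy => ?_, fun x => ?_, fun x => ?_⟩
  · rw [H₁.1.lap_add H₂.1 x hy]
    linarith [H₁.2.1 x y hy, H₂.2.1 x y hy]
  · simp only [H₁.2.2.1, H₂.2.2.1, Pi.add_apply]
    ring
  · simp only [H₁.2.2.2, H₂.2.2.2, Pi.add_apply]
    ring

lemma IsFirstCorrection.eqOn {g h : ℝ → ℝ} {φ φ' : ℝ → ℝ → ℝ} {a : ℝ} (ha : 0 < a)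
    (ha' : a < Real.pi / 2) (hψ : ∀ x, ∀ y ∈ Ioo (-1 : ℝ) 1, -a ^ 2 < deriv F (ψ x y))
    (H : IsFirstCorrection F ψ g h φ) (H' : IsFirstCorrection F ψ g h φ') :
    ∀ x, ∀ y ∈ Icc (-1 : ℝ) 1, φ' x y = φ x y := fun x y hy =>
  sub_eq_zero.1 <| eq_zero_of_dirichlet ha ha' (H'.1.sub H.1) hψ
    (fun x y hy => by rw [H'.1.lap_sub H.1 x hy]; linarith [H.2.1 x y hy, H'.2.1 x y hy])
    (fun x => by rw [H.2.2.1, H'.2.2.1, sub_self]) (fun x => by rw [H.2.2.2, H'.2.2.2, sub_self])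
    x y hy

variable {a : ℝ} {c : ℝ → ℝ} {y₀ : ℝ}

/-- Solvability of the linearized problem, with `C²` bounds on an inner horizontal line. -/
theorem exists_isFirstCorrection (hshear : ∀ x, ∀ y ∈ Icc (-1 : ℝ) 1, ψ x y = ψ 0 y)
    (ha : 0 < a) (ha' : a < Real.pi / 2) (hc : Continuous c)
    (hca : ∀ y ∈ Icc (-1 : ℝ) 1, -a ^ 2 < c y)
    (hcF : ∀ x, ∀ y ∈ Icc (-1 : ℝ) 1, deriv F (ψ x y) = c y) (hy₀ : y₀ ∈ Ioo (-1 : ℝ) 1) :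
    ∃ N : ℝ, ∀ (g h : ℝ → ℝ) (m : ℝ), ContDiff ℝ 2 g → Function.Periodic g (2 * Real.pi) →
      ContDiff ℝ 2 h → Function.Periodic h (2 * Real.pi) →
      (∀ x, |g x| ≤ m) → (∀ x, |h x| ≤ m) → ∃ φ : ℝ → ℝ → ℝ, IsFirstCorrection F ψ g h φ ∧
        ∀ x, |φ x y₀| ≤ N * m ∧ |iteratedDeriv 2 (fun s => φ s y₀) x| ≤ N * m := by
  obtain ⟨N₁, hN₁⟩ := exists_dirichlet_top ha ha' hc hca hy₀
  have hneg : ∀ {y : ℝ}, y ∈ Icc (-1 : ℝ) 1 → -y ∈ Icc (-1 : ℝ) 1 := fun hy =>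
    ⟨by linarith [hy.2], by linarith [hy.1]⟩
  have hneg' : ∀ {y : ℝ}, y ∈ Ioo (-1 : ℝ) 1 → -y ∈ Ioo (-1 : ℝ) 1 := fun hy =>
    ⟨by linarith [hy.2], by linarith [hy.1]⟩
  obtain ⟨N₂, hN₂⟩ := exists_dirichlet_top ha ha' (c := fun y => c (-y)) (by fun_prop)
    (fun y hy => hca (-y) (hneg hy)) (hneg' hy₀)
  -- The solution is a superposition: `h` drives the upper wall, while `g` drives the reflected
  -- problem with potential `c (-y)`.
  refine ⟨N₁ * |dy ψ 0 1| + N₂ * |dy ψ 0 (-1)|, fun g h m hg hgp hh hhp hgm hhm => ?_⟩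
  have hmul : ∀ {f : ℝ → ℝ} (d : ℝ), (∀ x, |f x| ≤ m) → ∀ x, |-f x * d| ≤ m * |d| :=
    fun d hf x => abs_mul_le_mul (by rw [abs_neg]; exact hf x) le_rfl
  obtain ⟨φ₁, C₁, L₁, T₁, B₁, E₁⟩ := hN₁ (fun x => -h x * dy ψ 0 1) _ (by fun_prop)
    (fun x => by simp only [hhp x]) (hmul _ hhm)
  obtain ⟨φ₂, C₂, L₂, T₂, B₂, E₂⟩ := hN₂ (fun x => -g x * dy ψ 0 (-1)) _ (by fun_prop)
    (fun x => by simp only [hgp x]) (hmul _ hgm)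
  refine ⟨fun x y => φ₁ x y + φ₂ x (-y), ⟨C₁.add C₂.reflect, fun x y hy => ?_, fun x => ?_,
    fun x => ?_⟩, fun x => ?_⟩
  · rw [C₁.lap_add C₂.reflect x hy, lap_reflect, L₁ x y hy, L₂ x (-y) (hneg' hy), neg_neg,
      hcF x y (Ioo_subset_Icc_self hy)]
    ring
  · simp only [T₁, B₂, dy_eq_of_shear hshear x (show (1 : ℝ) ∈ Icc (-1 : ℝ) 1 by norm_num),
      add_zero]
  · simp only [B₁, neg_neg, T₂, dy_eq_of_shear hshear x (show (-1 : ℝ) ∈ Icc (-1 : ℝ) 1 by norm_num),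
      zero_add]
  · have hbound : ∀ {s t : ℝ}, |s| ≤ N₁ * (m * |dy ψ 0 1|) → |t| ≤ N₂ * (m * |dy ψ 0 (-1)|) →
        |s + t| ≤ (N₁ * |dy ψ 0 1| + N₂ * |dy ψ 0 (-1)|) * m := fun hs ht => by
      linarith [abs_add_le _ _ |>.trans (add_le_add hs ht)]
    refine ⟨hbound (E₁ x).1 (E₂ x).1, ?_⟩
    rw [iteratedDeriv_fun_add (C₁.contDiffAt_fst x hy₀) (C₂.contDiffAt_fst x (hneg' hy₀))]
    exact hbound (E₁ x).2 (E₂ x).2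

/-- The first Fourier mode on the upper boundary. -/
lemma exists_cosine_mode (ha : 0 < a) (ha' : a < Real.pi / 2) (hc : Continuous c)
    (hca : ∀ y ∈ Icc (-1 : ℝ) 1, -a ^ 2 < c y) (hy₀ : y₀ ∈ Ioo (-1 : ℝ) 1) :
    ∃ b > 0, ∀ r z : ℝ, ∃ φ : ℝ → ℝ → ℝ, IsClassical φ ∧
      (∀ x, ∀ y ∈ Ioo (-1 : ℝ) 1, lap φ x y = c y * φ x y) ∧
      (∀ x, φ x 1 = r * Real.cos (x - z)) ∧ (∀ x, φ x (-1) = 0) ∧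
      ∀ x, φ x y₀ = r * b * Real.cos (x - z) := by
  have hqc : Continuous fun y => 1 + c y := by fun_prop
  have hqa : ∀ y ∈ Icc (-1 : ℝ) 1, -a ^ 2 < 1 + c y := fun y hy => by linarith [hca y hy]
  obtain ⟨B, B', hB⟩ := exists_isProfile ha ha' hqc hqa
  refine ⟨B y₀, hB.pos ha ha' hqc hqa y₀ ⟨hy₀.1, hy₀.2.le⟩, fun r z =>
    ⟨fun x y => r * Real.cos (x - z) * B y, ⟨fun x y _ => ?_, ?_, ?_⟩, fun x y hy => ?_,
    fun x => by simp [hB.top], fun x => by simp [hB.bot], fun x => by ring⟩⟩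
  · simp only [show x + 2 * Real.pi - z = x - z + 2 * Real.pi by ring, Real.cos_add_two_pi]
  · exact ContDiffOn.mul (by fun_prop) ((hB.contDiffOn hqc).comp contDiffOn_snd fun _ hp => hp.2)
  · exact ContinuousOn.mul (by fun_prop) (hB.cont.comp continuousOn_snd fun _ hp => hp.2)
  · have h1 : iteratedDeriv 2 (fun s => r * Real.cos (s - z) * B y) x
        = -(r * B y * Real.cos (x - z)) := by
      rw [← iteratedDeriv_two_cos_sub]
      congr 1
      funext s
      ring
    rw [lap, h1, iteratedDeriv_const_mul_field, hB.iteratedDeriv_two hy]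
    ring

/-- If the shear flow does not stagnate on both walls, multiples of the centred cosine are
attained on inner horizontal lines. -/
theorem exists_isFirstCorrection_cosine (hshear : ∀ x, ∀ y ∈ Icc (-1 : ℝ) 1, ψ x y = ψ 0 y)
    (ha : 0 < a) (ha' : a < Real.pi / 2) (hc : Continuous c)
    (hca : ∀ y ∈ Icc (-1 : ℝ) 1, -a ^ 2 < c y)
    (hcF : ∀ x, ∀ y ∈ Icc (-1 : ℝ) 1, deriv F (ψ x y) = c y) (hy₀ : y₀ ∈ Ioo (-1 : ℝ) 1)
    (hdy : dy ψ 0 1 ≠ 0 ∨ dy ψ 0 (-1) ≠ 0) :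
    ∃ σ τ : ℝ, ∀ r z : ℝ, ∃ φ : ℝ → ℝ → ℝ,
      IsFirstCorrection F ψ (fun x => r * σ * Real.cos (x - z)) (fun x => r * τ * Real.cos (x - z))
        φ ∧ ∀ x, φ x y₀ = r * Real.cos (x - z) := by
  rcases hdy with hd | hd
  · obtain ⟨b, hb, hmode⟩ := exists_cosine_mode ha ha' hc hca hy₀
    -- The profile damps the cosine by `b` at height `y₀`, so the wall value must be `r / b` times
    -- the cosine; the sign and `dy` undo the boundary condition `-h ∂_y ψ`.
    refine ⟨0, -(b * dy ψ 0 1)⁻¹, fun r z => ?_⟩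
    obtain ⟨φ, C, L, T, B, E⟩ := hmode (r / b) z
    refine ⟨φ, ⟨C, fun x y hy => ?_, fun x => ?_, fun x => ?_⟩, fun x => ?_⟩
    · rw [L x y hy, hcF x y (Ioo_subset_Icc_self hy), sub_self]
    · rw [T, dy_eq_of_shear hshear x (by norm_num)]
      field_simp
    · rw [B]; simp
    · rw [E, div_mul_cancel₀ _ hb.ne']
  · have hneg' : ∀ {y : ℝ}, y ∈ Ioo (-1 : ℝ) 1 → -y ∈ Ioo (-1 : ℝ) 1 := fun hy =>
      ⟨by linarith [hy.2], by linarith [hy.1]⟩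
    obtain ⟨b, hb, hmode⟩ := exists_cosine_mode ha ha' (c := fun y => c (-y)) (by fun_prop)
      (fun y hy => hca (-y) ⟨by linarith [hy.2], by linarith [hy.1]⟩) (hneg' hy₀)
    refine ⟨-(b * dy ψ 0 (-1))⁻¹, 0, fun r z => ?_⟩
    obtain ⟨φ, C, L, T, B, E⟩ := hmode (r / b) z
    refine ⟨fun x y => φ x (-y), ⟨C.reflect, fun x y hy => ?_, fun x => ?_, fun x => ?_⟩,
      fun x => ?_⟩
    · rw [lap_reflect, L x (-y) (hneg' hy), hcF x y (Ioo_subset_Icc_self hy), neg_neg, sub_self]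
    · simp [B]
    · simp only [neg_neg]
      rw [T, dy_eq_of_shear hshear x (by norm_num)]
      field_simp
    · simp only
      rw [E, div_mul_cancel₀ _ hb.ne']

/-! ### Openness and density of `B0`. -/

lemma mem_B0_iff {α : ℝ} {p : HolderC2 α × HolderC2 α} :
    p ∈ B0 α F ψ y₀ ↔ ∃ φ : ℝ → ℝ → ℝ, IsFirstCorrection F ψ p.1 p.2 φ ∧
      HasNondegenerateMax (fun x => φ x y₀) := Iff.rfl

/-- The trace of a classical function on an inner horizontal line is periodic. -/
lemma IsClassical.periodic_fst {u : ℝ → ℝ → ℝ} (hu : IsClassical u) (hy₀ : y₀ ∈ Ioo (-1 : ℝ) 1) :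
    Function.Periodic (fun x => u x y₀) (2 * Real.pi) :=
  fun x => hu.1 x y₀ (Ioo_subset_Icc_self hy₀)

/-- By linearity, a correction for `p'` is that for `p` plus one for `p' - p`, which is `C²`-small
at height `y₀`. Membership only asks for some correction, so uniqueness plays no role. -/
theorem isOpen_B0 (α : ℝ) (hshear : ∀ x, ∀ y ∈ Icc (-1 : ℝ) 1, ψ x y = ψ 0 y)
    (ha : 0 < a) (ha' : a < Real.pi / 2) (hc : Continuous c)
    (hca : ∀ y ∈ Icc (-1 : ℝ) 1, -a ^ 2 < c y)
    (hcF : ∀ x, ∀ y ∈ Icc (-1 : ℝ) 1, deriv F (ψ x y) = c y) (hy₀ : y₀ ∈ Ioo (-1 : ℝ) 1) :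
    IsOpen (B0 α F ψ y₀) := by
  obtain ⟨N, hN⟩ := exists_isFirstCorrection hshear ha ha' hc hca hcF hy₀
  rw [Metric.isOpen_iff]
  intro p hp
  obtain ⟨φ, hφ, hnd⟩ := mem_B0_iff.1 hp
  obtain ⟨ε, hε, hstable⟩ := hnd.exists_stable (hφ.1.contDiff_fst hy₀) (hφ.1.periodic_fst hy₀)
  have hN1 : 0 < |N| + 1 := by positivity
  refine ⟨ε / (|N| + 1), by positivity, fun p' hp' => ?_⟩
  rw [Metric.mem_ball, dist_eq_norm, lt_div_iff₀ hN1] at hp'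
  set m := ‖p' - p‖
  obtain ⟨v, hv, hvb⟩ := hN (p' - p).1 (p' - p).2 m (p' - p).1.contDiff (p' - p).1.periodic
    (p' - p).2.contDiff (p' - p).2.periodic
    (fun x => ((p' - p).1.abs_apply_le_norm x).trans (norm_fst_le _))
    (fun x => ((p' - p).2.abs_apply_le_norm x).trans (norm_snd_le _))
  have hle : N * m ≤ ε := by
    have : 0 ≤ m := norm_nonneg _
    nlinarith [le_abs_self N]
  refine mem_B0_iff.2 ⟨fun x y => φ x y + v x y, ?_, hstable (fun x => v x y₀) (hv.1.contDiff_fst hy₀) (hv.1.periodic_fst hy₀)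
    (fun x => (hvb x).1.trans hle) (fun x => (hvb x).2.trans hle)⟩
  have h := hφ.add hv
  rw [← HolderC2.coe_add, ← HolderC2.coe_add, ← Prod.fst_add, ← Prod.snd_add,
    add_sub_cancel] at h
  exact h

theorem dense_B0 {α : ℝ} (hα : α ∈ Ioo (0 : ℝ) 1)
    (hshear : ∀ x, ∀ y ∈ Icc (-1 : ℝ) 1, ψ x y = ψ 0 y)
    (ha : 0 < a) (ha' : a < Real.pi / 2) (hc : Continuous c)
    (hca : ∀ y ∈ Icc (-1 : ℝ) 1, -a ^ 2 < c y)
    (hcF : ∀ x, ∀ y ∈ Icc (-1 : ℝ) 1, deriv F (ψ x y) = c y) (hy₀ : y₀ ∈ Ioo (-1 : ℝ) 1)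
    (hdy : dy ψ 0 1 ≠ 0 ∨ dy ψ 0 (-1) ≠ 0) : Dense (B0 α F ψ y₀) := by
  obtain ⟨N, hN⟩ := exists_isFirstCorrection hshear ha ha' hc hca hcF hy₀
  obtain ⟨σ, τ, hmode⟩ := exists_isFirstCorrection_cosine hshear ha ha' hc hca hcF hy₀ hdy
  rw [Metric.dense_iff]
  intro p ε hε
  obtain ⟨φ, hφ, -⟩ := hN p.1 p.2 ‖p‖ p.1.contDiff p.1.periodic p.2.contDiff p.2.periodic
    (fun x => (p.1.abs_apply_le_norm x).trans (norm_fst_le _))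
    (fun x => (p.2.abs_apply_le_norm x).trans (norm_snd_le _))
  have hcd := hφ.1.contDiff_fst hy₀
  obtain ⟨z, hz⟩ := exists_forall_le_of_periodic hcd.continuous (hφ.1.periodic_fst hy₀)
  have hS : 0 < 5 * (|σ| + |τ|) + 1 := by positivity
  -- Of the amplitudes `t` and `t / 2` at most one makes the new maximum vanish. The 5 is the norm
  -- constant of the cosine; the added 1 keeps the divisor positive.
  obtain ⟨r, hr, hr0, hrε⟩ : ∃ r > 0, φ z y₀ + r ≠ 0 ∧ r * (5 * (|σ| + |τ|) + 1) < ε := by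
    set t := ε / (5 * (|σ| + |τ|) + 1) / 2 with ht
    have ht0 : 0 < t := by positivity
    have htε : t * (5 * (|σ| + |τ|) + 1) = ε / 2 := by rw [ht]; field_simp
    by_cases h : φ z y₀ + t = 0
    · exact ⟨t / 2, by positivity, fun h' => by linarith, by
        rw [div_mul_eq_mul_div, htε]; linarith⟩
    · exact ⟨t, ht0, h, by rw [htε]; linarith⟩
  obtain ⟨v, hv, hvy⟩ := hmode r z
  set d : HolderC2 α × HolderC2 α := (HolderC2.cosine hα (r * σ) z, HolderC2.cosine hα (r * τ) z)
    with hd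
  refine ⟨p + d, ?_, mem_B0_iff.2 ⟨_, hφ.add hv, ?_⟩⟩
  · rw [Metric.mem_ball, dist_eq_norm, add_sub_cancel_left, Prod.norm_def]
    have h1 := HolderC2.norm_cosine_le hα (r * σ) z
    have h2 := HolderC2.norm_cosine_le hα (r * τ) z
    rw [abs_mul, abs_of_pos hr] at h1 h2
    have h3 := mul_nonneg hr.le (abs_nonneg σ)
    have h4 := mul_nonneg hr.le (abs_nonneg τ)
    exact max_lt (by simp only [hd]; linarith) (by simp only [hd]; linarith)
  · simp only [hvy]
    exact hasNondegenerateMax_add_cos hcd hz hr hr0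

end FirstCorrection

end Channel

/-! ### Assembly: reduction to a shear flow, then solvability, uniqueness, openness and density. -/

theorem lemma4p4 (α : ℝ) (hα : α ∈ Set.Ioo (0 : ℝ) 1)
    (F : ℝ → ℝ) (hF : ContDiff ℝ 4 F)
    (hstable : ∀ s, -Channel.firstDirichletEigenvalue < deriv F s)
    (cG cH : ℝ) (ψ₀ : ℝ → ℝ → ℝ) (hψ : Channel.IsSteadyState F cG cH ψ₀)
    (hnc : Channel.IsNonconstant ψ₀)
    (y₀ : ℝ) (hy₀ : y₀ ∈ Set.Ioo (-1 : ℝ) 1) (hstag : Channel.StagnatesAt ψ₀ y₀) :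
    (∀ g h : Channel.HolderC2 α, ∃ φ : ℝ → ℝ → ℝ,
      Channel.IsFirstCorrection F ψ₀ g h φ ∧
      ∀ φ' : ℝ → ℝ → ℝ, Channel.IsFirstCorrection F ψ₀ g h φ' →
        ∀ x, ∀ y ∈ Set.Icc (-1 : ℝ) 1, φ' x y = φ x y) ∧
    IsOpen (Channel.B0 α F ψ₀ y₀) ∧ Dense (Channel.B0 α F ψ₀ y₀) := by
  obtain ⟨hshear, a, ha, ha', c, hc, hca, hcF⟩ := hψ.exists_potential hF hstable
  have hdy := hψ.dy_ne_zero hF hnc hshear ha ha' hc hca hcF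
  refine ⟨fun g h => ?_, Channel.isOpen_B0 α hshear ha ha' hc hca hcF hy₀,
    Channel.dense_B0 hα hshear ha ha' hc hca hcF hy₀ hdy⟩
  obtain ⟨N, hN⟩ := Channel.exists_isFirstCorrection hshear ha ha' hc hca hcF hy₀
  obtain ⟨φ, hφ, -⟩ := hN g h (max ‖g‖ ‖h‖) g.contDiff g.periodic h.contDiff h.periodic
    (fun x => (g.abs_apply_le_norm x).trans (le_max_left _ _))
    (fun x => (h.abs_apply_le_norm x).trans (le_max_right _ _))
  exact ⟨φ, hφ, fun φ' hφ' => hφ.eqOn ha ha'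
    (fun x y hy => by rw [hcF x y (Ioo_subset_Icc_self hy)]; exact hca y (Ioo_subset_Icc_self hy))
    hφ'⟩
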